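/- Let $k$ be a field of characteristic zero; algebras are associative and unital over $k$, and $\otimes=\otimes_k$. Let $A=\bigoplus_{n\ge 0}A_n$ be a nonzero connected graded algebra, i.e. $A_iA_j\subseteq A_{i+j}$ and $A_0=k\,1_A$, and put $A_+=\bigoplus_{n\ge 1}A_n$. Grade $A\otimes A$ by $(A\otimes A)_n=\bigoplus_{i+j=n}A_i\otimes A_j$; for subspaces $V,W\subseteq A$ write $(V\otimes W)_n=(V\otimes W)\cap(A\otimes A)_n$. Let $\Delta:A\to A\otimes A$ be a pseudo-comultiplication, i.e. a homomorphism of graded algebras such that $\Delta(a)\in 1\otimes a+a\otimes 1+(A_+\otimes A_+)_{n}$ for every $n\ge 1$ and $a\in A_n$. Let $B\subseteq A$ be a graded subalgebra with $\Delta(B)\subseteq B\otimes B$. Then there are a totally ordered set $(\Gamma,\le)$ and a family $(z_\gamma)_{\gamma\in\Gamma}$ of nonzero homogeneous elements of $A$ of positive degree such that, with $A^{<\gamma}$ denoting the subalgebra of $A$ generated by $B$ and $\{z_\delta\mid\delta\in\Gamma,\ \delta<\gamma\}$, and $A_+^{<\gamma}=A^{<\gamma}\cap A_+$: 1. $\Delta(z_\gamma)\in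 1\otimes z_\gamma+z_\gamma\otimes 1+(A_+^{<\gamma}\otimes A_+^{<\gamma})_{\deg(z_\gamma)}$ for every $\gamma\in\Gamma$; 2. $z_\gamma a-a z_\gamma\in A^{<\gamma}$ for every $\gamma\in\Gamma$ and $a\in A^{<\gamma}$; 3. the monomials $z_{\gamma_1}\cdots z_{\gamma_n}$, indexed by the finite nondecreasing sequences $\gamma_1\le\cdots\le\gamma_n$ in $\Gamma$ $(n\ge 0)$, form a basis consisting of homogeneous elements of $A$ as a left $B$-module, and also as a right $B$-module; 4. $\operatorname{gkdim}A=\operatorname{gkdim}B+\#(\Gamma)$ in $[0,\infty]$, where $\#(\Gamma)$ is the number of elements of $\Gamma$ ($\infty$ if $\Gamma$ is infinite) and $\operatorname{gkdim}R=\sup_V\limsup_{n\to\infty}\log_n\dim_k(k+V+V^2+\cdots+V^n)$ is the Gelfand-Kirillov dimension, $V$ running over the finite-dimensional subspaces of $R$. -/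

import Mathlib

open scoped TensorProduct ENNReal

universe u v

noncomputable section

namespace PseudoComul

variable {k : Type u} [Field k] {A : Type v} [Ring A] [Algebra k A]

/-- The part `A₊ = ⨁_{n ≥ 1} Aₙ` of positive degree. -/
def posPart (𝒜 : ℕ → Submodule k A) : Submodule k A :=
  ⨆ n : ℕ, ⨆ _ : 1 ≤ n, 𝒜 n

/-- For subspaces `V, W` of `A`, the subspace `V ⊗ W` of `A ⊗ A`
(over a field the natural map from `V ⊗ W` to `A ⊗ A` is injective). -/
def tensorSub (V W : Submodule k A) : Submodule k (A ⊗[k] A) :=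
  LinearMap.range (TensorProduct.mapIncl V W)

/-- The total grading on `A ⊗ A`: `(A ⊗ A)ₙ = ∑_{i + j = n} Aᵢ ⊗ Aⱼ`. -/
def tensorGrading (𝒜 : ℕ → Submodule k A) (n : ℕ) : Submodule k (A ⊗[k] A) :=
  ⨆ p ∈ Finset.HasAntidiagonal.antidiagonal n, tensorSub (𝒜 p.1) (𝒜 p.2)

/-- A pseudo-comultiplication on a graded algebra: a homomorphism of graded algebras
`Δ : A → A ⊗ A` with `Δ a ∈ 1 ⊗ a + a ⊗ 1 + (A₊ ⊗ A₊)ₙ` for all `a ∈ Aₙ`, `n ≥ 1`. -/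
structure IsPseudoComul (𝒜 : ℕ → Submodule k A) (Δ : A →ₐ[k] A ⊗[k] A) : Prop where
  map_mem : ∀ n : ℕ, ∀ a ∈ 𝒜 n, Δ a ∈ tensorGrading 𝒜 n
  primitive_mod : ∀ n : ℕ, 1 ≤ n → ∀ a ∈ 𝒜 n,
    Δ a - (1 ⊗ₜ[k] a + a ⊗ₜ[k] 1) ∈
      tensorSub (posPart 𝒜) (posPart 𝒜) ⊓ tensorGrading 𝒜 n

/-- The subalgebra `A^{<γ}` generated by `B` and all `z δ` with `δ < γ`. -/
def below (B : Subalgebra k A) {Γ : Type*} [LinearOrder Γ] (z : Γ → A) (γ : Γ) :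
    Subalgebra k A :=
  Algebra.adjoin k ((B : Set A) ∪ z '' Set.Iio γ)

/-- The positive part `A₊^{<γ} = A^{<γ} ∩ A₊` of `A^{<γ}`. -/
def belowPos (𝒜 : ℕ → Submodule k A) (B : Subalgebra k A) {Γ : Type*} [LinearOrder Γ]
    (z : Γ → A) (γ : Γ) : Submodule k A :=
  Subalgebra.toSubmodule (below B z γ) ⊓ posPart 𝒜

/-- Finite nondecreasing sequences in `Γ` (the empty one included). -/
abbrev NondecSeq (Γ : Type*) [LinearOrder Γ] : Type _ :=
  {l : List Γ // l.Pairwise (· ≤ ·)}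

/-- The ordered monomial `z_{γ₁} ⋯ z_{γₙ}` of a nondecreasing sequence `γ₁ ≤ ⋯ ≤ γₙ`. -/
def monomial {Γ : Type*} [LinearOrder Γ] (z : Γ → A) (l : NondecSeq Γ) : A :=
  (l.1.map z).prod

variable (k) in
/-- The Gelfand-Kirillov dimension
`sup_V limsup_n log_n dim (k + V + V² + ⋯ + Vⁿ)`, where `V` runs over the finite dimensional
subspaces, with values in `[0, ∞]`. (For a nonzero algebra all the logarithms are
nonnegative once `n ≥ 2`.) -/
def gkdim (R : Type*) [Ring R] [Algebra k R] : ℝ≥0∞ :=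
  ⨆ V : Submodule k R, ⨆ _ : V.FG,
    Filter.limsup (fun n : ℕ =>
      ENNReal.ofReal (Real.logb (n : ℝ)
        (Module.finrank k ↥(∑ i ∈ Finset.range (n + 1), V ^ i) : ℝ))) Filter.atTop

end PseudoComul

end

/-! Call a graded subalgebra `X` with Δ(X) ⊆ X ⊗ X admissible. The extension from `B` to `A` is
refined into a totally ordered family of steps C ⊂ C[z] between admissible subalgebras, where z is
homogeneous of degree d, C[z] agrees with C below degree d, and [z, C] ⊆ C. The steps with their
order are Γ, and C turns out to be A^{<γ}.

Commutators are controlled by maximality. Let L ⊆ U be admissible and agree below degree n ≥ 1. For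
a subspace of U_n containing L_n, let C be the largest admissible subalgebra of U whose degree n
part lies in it. If z ∈ U_n, then C and [z, C] generate an admissible algebra, and the degree n
component of [z, c] is [z, c_0] = 0 because c_0 is a scalar. Maximality gives [z, C] ⊆ C
(`comm_mem_levelMax`). Choosing the subspaces along a well-ordering ρ gives increasing algebras C_t
with C_x[x] ⊆ C_t for x < t. Between the union of L and these C_x[x], and C_t, there may remain a
gap, but its ends agree through degree n, so it is refined again in degree n + 1. The resulting
order on the steps need not be a well-order. The steps of degree at most m are well-ordered, however
(`Leaf.exists_min`), since they appear at bounded depth of the recursion.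

The coproduct is triangular because Δ(z) - 1 ⊗ z - z ⊗ 1 has only components of bidegree (i, j) with
0 < i, j < d, where C[z] and C agree (`primitive_mod_of_agree`). For independence, take a functional
f concentrated in degree d, zero on C and with f(z) = 1. Then (id ⊗ f)Δ restricts to a derivation of
C[z] that kills C and sends z to 1 (`IsStep.exists_deriv`). Differentiating a relation with respect
to its largest generator shortens it, and characteristic zero keeps the coefficients
(`IsStepChain.coeff_eq_zero`). Spanning is an induction on the degree and on the first bad step
(`IsStepChain.mem_monomialSums_Iic`).

For the Gelfand-Kirillov dimension, the construction is also run from k to `B`. Both `B` and `A`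
then have k-bases of ordered monomials in homogeneous generators of positive degree, and such a
basis makes the dimension the number of generators (`gkdim_eq_card`). -/

namespace PseudoComul

open GradedAlgebra (proj)

/-! ### Homogeneous components and the counit -/

section Grading

variable {k : Type u} [Field k] {A : Type v} [Ring A] [Algebra k A]
variable (𝒜 : ℕ → Submodule k A) [GradedAlgebra 𝒜]

theorem proj_mem (i : ℕ) (a : A) : proj 𝒜 i a ∈ 𝒜 i := by
  rw [GradedAlgebra.proj_apply]; exact SetLike.coe_mem _

theorem proj_of_mem {i : ℕ} {a : A} (h : a ∈ 𝒜 i) : proj 𝒜 i a = a := by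
  rw [GradedAlgebra.proj_apply, DirectSum.decompose_of_mem_same 𝒜 h]

theorem proj_of_mem_ne {i j : ℕ} {a : A} (h : a ∈ 𝒜 i) (hij : i ≠ j) : proj 𝒜 j a = 0 := by
  rw [GradedAlgebra.proj_apply, DirectSum.decompose_of_mem_ne 𝒜 h hij]

theorem proj_mul (n : ℕ) (a b : A) :
    proj 𝒜 n (a * b) =
      ∑ p ∈ Finset.HasAntidiagonal.antidiagonal n, proj 𝒜 p.1 a * proj 𝒜 p.2 b := by
  simp only [GradedAlgebra.proj_apply, DirectSum.decompose_mul]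
  exact DirectSum.coe_mul_apply_eq_sum_antidiagonal 𝒜 _ _ n

theorem proj_mul_of_mem_left {i : ℕ} {a : A} (ha : a ∈ 𝒜 i) (n : ℕ) (b : A) :
    proj 𝒜 (i + n) (a * b) = a * proj 𝒜 n b := by
  simp only [GradedAlgebra.proj_apply]
  exact DirectSum.coe_decompose_mul_add_of_left_mem 𝒜 ha

theorem proj_mul_of_mem_right {i : ℕ} {b : A} (hb : b ∈ 𝒜 i) (n : ℕ) (a : A) :
    proj 𝒜 (n + i) (a * b) = proj 𝒜 n a * b := by
  simp only [GradedAlgebra.proj_apply]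
  exact DirectSum.coe_decompose_mul_add_of_right_mem 𝒜 hb

theorem one_mem_zero : (1 : A) ∈ 𝒜 0 := SetLike.one_mem_graded 𝒜

theorem algebraMap_mem_zero (r : k) : algebraMap k A r ∈ 𝒜 0 := by
  rw [Algebra.algebraMap_eq_smul_one]; exact (𝒜 0).smul_mem _ (one_mem_zero 𝒜)

open Classical in
theorem exists_sum_proj (a : A) : ∃ s : Finset ℕ, a = ∑ i ∈ s, proj 𝒜 i a := by
  refine ⟨DFinsupp.support (DirectSum.decompose 𝒜 a), ?_⟩
  conv_lhs => rw [← DirectSum.sum_support_decompose 𝒜 a]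
  simp [GradedAlgebra.proj_apply]

theorem mem_of_proj_mem (M : AddSubmonoid A) {a : A} (h : ∀ i, proj 𝒜 i a ∈ M) : a ∈ M := by
  obtain ⟨s, hs⟩ := exists_sum_proj 𝒜 a
  rw [hs]; exact M.sum_mem fun i _ => h i

theorem exists_counit (connected : 𝒜 0 = Submodule.span k {(1 : A)}) [Nontrivial A] :
    ∃ ε : A →ₗ[k] k, ∀ a, proj 𝒜 0 a = ε a • (1 : A) := by
  have h1 : (1 : A) ∉ (⊥ : Submodule k A) := by simp
  obtain ⟨g, hg, -⟩ := Submodule.exists_le_ker_of_notMem h1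
  refine ⟨(g 1)⁻¹ • (g ∘ₗ proj 𝒜 0), fun a => ?_⟩
  have := proj_mem 𝒜 0 a
  rw [connected, Submodule.mem_span_singleton] at this
  obtain ⟨c, hc⟩ := this
  simp only [LinearMap.smul_apply, LinearMap.comp_apply, ← hc, map_smul, smul_eq_mul]
  rw [mul_comm c, inv_mul_cancel_left₀ hg]

theorem posPart_proj_zero {a : A} (ha : a ∈ posPart 𝒜) : proj 𝒜 0 a = 0 := by
  have : posPart 𝒜 ≤ LinearMap.ker (proj 𝒜 0) :=
    iSup_le fun n => iSup_le fun hn => fun x hx => proj_of_mem_ne 𝒜 hx (by omega)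
  exact this ha

end Grading

/-! ### Tensor products of subspaces and subalgebras -/

section Tensor

variable {k : Type u} [Field k] {A : Type v} [Ring A] [Algebra k A]

theorem mem_posPart (𝒜 : ℕ → Submodule k A) {n : ℕ} (hn : 1 ≤ n) {a : A} (ha : a ∈ 𝒜 n) :
    a ∈ posPart 𝒜 :=
  Submodule.mem_iSup_of_mem n (Submodule.mem_iSup_of_mem hn ha)

theorem tensorSub_le {V W : Submodule k A} {X : Submodule k (A ⊗[k] A)}
    (h : ∀ v ∈ V, ∀ w ∈ W, v ⊗ₜ[k] w ∈ X) : tensorSub V W ≤ X := by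
  rintro _ ⟨t, rfl⟩
  induction t with
  | zero => simp
  | tmul v w => simpa [TensorProduct.mapIncl] using h v v.2 w w.2
  | add s t hs ht => rw [map_add]; exact X.add_mem hs ht

theorem tmul_mem_tensorSub {V W : Submodule k A} {v w : A} (hv : v ∈ V) (hw : w ∈ W) :
    v ⊗ₜ[k] w ∈ tensorSub V W :=
  ⟨(⟨v, hv⟩ : V) ⊗ₜ (⟨w, hw⟩ : W), by simp [TensorProduct.mapIncl]⟩

theorem tensorSub_mono {V W V' W' : Submodule k A} (hV : V ≤ V') (hW : W ≤ W') :
    tensorSub V W ≤ tensorSub V' W' :=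
  tensorSub_le fun _ hv _ hw => tmul_mem_tensorSub (hV hv) (hW hw)

/-- The subalgebra `C ⊗ C` of `A ⊗ A`. -/
def tensorSq (C : Subalgebra k A) : Subalgebra k (A ⊗[k] A) :=
  (Algebra.TensorProduct.map C.val C.val).range

theorem tmul_mem_tensorSq {C : Subalgebra k A} {a b : A} (ha : a ∈ C) (hb : b ∈ C) :
    a ⊗ₜ[k] b ∈ tensorSq C :=
  ⟨(⟨a, ha⟩ : C) ⊗ₜ (⟨b, hb⟩ : C), by simp⟩

theorem tensorSq_toSubmodule (C : Subalgebra k A) :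
    Subalgebra.toSubmodule (tensorSq C) =
      tensorSub (Subalgebra.toSubmodule C) (Subalgebra.toSubmodule C) := by
  apply le_antisymm
  · rintro _ ⟨t, rfl⟩
    induction t with
    | zero => simp
    | tmul v w => exact tmul_mem_tensorSub v.2 w.2
    | add s t hs ht => rw [map_add]; exact Submodule.add_mem _ hs ht
  · exact tensorSub_le fun v hv w hw => tmul_mem_tensorSq hv hw

theorem mem_tensorSq {C : Subalgebra k A} {t : A ⊗[k] A} :
    t ∈ tensorSq C ↔ t ∈ tensorSub (Subalgebra.toSubmodule C) (Subalgebra.toSubmodule C) := by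
  rw [← tensorSq_toSubmodule]; rfl

theorem tensorSq_induction {C : Subalgebra k A} (X : Submodule k (A ⊗[k] A))
    (h : ∀ a ∈ C, ∀ b ∈ C, a ⊗ₜ[k] b ∈ X) {t : A ⊗[k] A} (ht : t ∈ tensorSq C) : t ∈ X :=
  tensorSub_le h (mem_tensorSq.1 ht)

theorem tensorSq_mono {C D : Subalgebra k A} (h : C ≤ D) : tensorSq C ≤ tensorSq D := fun _ ht =>
  tensorSq_induction (Subalgebra.toSubmodule (tensorSq D))
    (fun _ ha _ hb => tmul_mem_tensorSq (h ha) (h hb)) ht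

end Tensor

/-! ### Admissible subalgebras -/

section Admissible

variable {k : Type u} [Field k] {A : Type v} [Ring A] [Algebra k A]
variable (𝒜 : ℕ → Submodule k A) [GradedAlgebra 𝒜] (Δ : A →ₐ[k] A ⊗[k] A)

/-- The elements all of whose components lie in `X` and whose coproduct lies in `X ⊗ X`. -/
def interiorOf (X : Subalgebra k A) : Subalgebra k A where
  carrier := {a | (∀ i, proj 𝒜 i a ∈ X) ∧ Δ a ∈ tensorSq X}
  mul_mem' {a b} ha hb := ⟨fun i => by
      rw [proj_mul]; exact sum_mem fun p _ => mul_mem (ha.1 _) (hb.1 _), by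
      rw [map_mul]; exact mul_mem ha.2 hb.2⟩
  add_mem' {a b} ha hb := ⟨fun i => by rw [map_add]; exact add_mem (ha.1 i) (hb.1 i), by
      rw [map_add]; exact add_mem ha.2 hb.2⟩
  algebraMap_mem' r := ⟨fun i => by
      by_cases hi : 0 = i
      · subst hi; rw [proj_of_mem 𝒜 (algebraMap_mem_zero 𝒜 r)]; exact X.algebraMap_mem r
      · rw [proj_of_mem_ne 𝒜 (algebraMap_mem_zero 𝒜 r) hi]; exact X.zero_mem, by
      rw [AlgHom.commutes]; exact (tensorSq X).algebraMap_mem r⟩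

/-- Graded subalgebras `X` with `Δ X ⊆ X ⊗ X`. -/
def Admissible (X : Subalgebra k A) : Prop := X ≤ interiorOf 𝒜 Δ X

variable {𝒜 Δ}

theorem interiorOf_mono {X Y : Subalgebra k A} (h : X ≤ Y) :
    interiorOf 𝒜 Δ X ≤ interiorOf 𝒜 Δ Y :=
  fun _ ha => ⟨fun i => h (ha.1 i), tensorSq_mono h ha.2⟩

theorem Admissible.proj_mem {X : Subalgebra k A} (h : Admissible 𝒜 Δ X) {a : A} (ha : a ∈ X)
    (i : ℕ) : proj 𝒜 i a ∈ X := (h ha).1 i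

theorem Admissible.map_mem {X : Subalgebra k A} (h : Admissible 𝒜 Δ X) {a : A} (ha : a ∈ X) :
    Δ a ∈ tensorSq X := (h ha).2

theorem Admissible.sSup {S : Set (Subalgebra k A)} (h : ∀ X ∈ S, Admissible 𝒜 Δ X) :
    Admissible 𝒜 Δ (sSup S) :=
  sSup_le fun X hX => (h X hX).trans (interiorOf_mono (le_sSup hX))

theorem Admissible.iSup {ι : Sort*} {S : ι → Subalgebra k A} (h : ∀ i, Admissible 𝒜 Δ (S i)) :
    Admissible 𝒜 Δ (⨆ i, S i) :=
  iSup_le fun i => (h i).trans (interiorOf_mono (le_iSup S i))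

theorem Admissible.sup {X Y : Subalgebra k A} (hX : Admissible 𝒜 Δ X) (hY : Admissible 𝒜 Δ Y) :
    Admissible 𝒜 Δ (X ⊔ Y) :=
  sup_le (hX.trans (interiorOf_mono le_sup_left)) (hY.trans (interiorOf_mono le_sup_right))

/-- Since `interiorOf` is itself a subalgebra and is monotone, admissibility has to be checked on
generators only. -/
theorem Admissible.sup_adjoin {X : Subalgebra k A} (hX : Admissible 𝒜 Δ X) {s : Set A}
    (hs : s ⊆ interiorOf 𝒜 Δ (X ⊔ Algebra.adjoin k s)) :
    Admissible 𝒜 Δ (X ⊔ Algebra.adjoin k s) :=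
  sup_le (hX.trans (interiorOf_mono le_sup_left)) (Algebra.adjoin_le hs)

theorem admissible_bot : Admissible 𝒜 Δ (⊥ : Subalgebra k A) := bot_le

theorem admissible_top : Admissible 𝒜 Δ (⊤ : Subalgebra k A) := fun a _ =>
  ⟨fun _ => trivial, by
    induction Δ a using TensorProduct.induction_on with
    | zero => exact zero_mem _
    | tmul a b => exact tmul_mem_tensorSq trivial trivial
    | add s t hs ht => exact add_mem hs ht⟩

/-- The difference lies in U ⊗ U and in A₊ ⊗ A₊ and has total degree n. Its components therefore
have bidegrees (i, j) with both entries positive and less than n, and in these degrees U is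
contained in L. -/
theorem primitive_mod_of_agree (hΔ : IsPseudoComul 𝒜 Δ) {L U : Subalgebra k A}
    (hU : Admissible 𝒜 Δ U) {n : ℕ} (hn : 1 ≤ n) (agree : ∀ i < n, ∀ a ∈ U, a ∈ 𝒜 i → a ∈ L)
    {z : A} (hz : z ∈ U) (hzn : z ∈ 𝒜 n) :
    Δ z - (1 ⊗ₜ[k] z + z ⊗ₜ[k] 1) ∈
      tensorSub (Subalgebra.toSubmodule L ⊓ posPart 𝒜) (Subalgebra.toSubmodule L ⊓ posPart 𝒜) := by
  obtain ⟨hpos, hgr⟩ := hΔ.primitive_mod n hn z hzn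
  have hyU : Δ z - (1 ⊗ₜ[k] z + z ⊗ₜ[k] 1) ∈ tensorSq U :=
    sub_mem (hU.map_mem hz) (add_mem (tmul_mem_tensorSq (one_mem _) hz)
      (tmul_mem_tensorSq hz (one_mem _)))
  revert hpos hgr hyU
  generalize Δ z - (1 ⊗ₜ[k] z + z ⊗ₜ[k] 1) = y
  intro hpos hgr hyU
  -- `P` is the identity on total degree n, so y may be replaced by the sum of its bihomogeneous
  -- components.
  let P : A ⊗[k] A →ₗ[k] A ⊗[k] A := ∑ p ∈ Finset.HasAntidiagonal.antidiagonal n,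
    TensorProduct.map (proj 𝒜 p.1) (proj 𝒜 p.2)
  have hP : y = P y := by
    have : tensorGrading 𝒜 n ≤ LinearMap.eqLocus LinearMap.id P := by
      refine iSup_le fun p => iSup_le fun hp => tensorSub_le fun a ha b hb => ?_
      change a ⊗ₜ[k] b = P (a ⊗ₜ[k] b)
      simp only [P, LinearMap.sum_apply, TensorProduct.map_tmul]
      rw [Finset.sum_eq_single p]
      · rw [proj_of_mem 𝒜 ha, proj_of_mem 𝒜 hb]
      · intro q hq hqp
        have : p.1 ≠ q.1 := by
          rw [Finset.HasAntidiagonal.mem_antidiagonal] at hp hq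
          intro h; exact hqp (Prod.ext h.symm (by omega))
        rw [proj_of_mem_ne 𝒜 ha this, TensorProduct.zero_tmul]
      · exact fun h => absurd hp h
    exact this hgr
  rw [hP]
  simp only [P, LinearMap.sum_apply]
  refine Submodule.sum_mem _ fun p hp => ?_
  rw [Finset.HasAntidiagonal.mem_antidiagonal] at hp
  by_cases h1 : p.1 = 0
  · have : tensorSub (posPart 𝒜) (posPart 𝒜) ≤
        LinearMap.ker (TensorProduct.map (proj 𝒜 p.1) (proj 𝒜 p.2)) :=
      tensorSub_le fun a ha b hb => by
        rw [LinearMap.mem_ker, TensorProduct.map_tmul, h1, posPart_proj_zero 𝒜 ha,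
          TensorProduct.zero_tmul]
    rw [LinearMap.mem_ker.1 (this hpos)]; exact Submodule.zero_mem _
  by_cases h2 : p.2 = 0
  · have : tensorSub (posPart 𝒜) (posPart 𝒜) ≤
        LinearMap.ker (TensorProduct.map (proj 𝒜 p.1) (proj 𝒜 p.2)) :=
      tensorSub_le fun a ha b hb => by
        rw [LinearMap.mem_ker, TensorProduct.map_tmul, h2, posPart_proj_zero 𝒜 hb,
          TensorProduct.tmul_zero]
    rw [LinearMap.mem_ker.1 (this hpos)]; exact Submodule.zero_mem _
  have key := tensorSq_induction ((tensorSub (Subalgebra.toSubmodule L ⊓ posPart 𝒜)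
      (Subalgebra.toSubmodule L ⊓ posPart 𝒜)).comap
      (TensorProduct.map (proj 𝒜 p.1) (proj 𝒜 p.2))) (fun a ha b hb => by
    rw [Submodule.mem_comap, TensorProduct.map_tmul]
    have aux : ∀ i, i ≠ 0 → i < n → ∀ a ∈ U,
        proj 𝒜 i a ∈ Subalgebra.toSubmodule L ⊓ posPart 𝒜 := fun i hi hin a ha =>
      ⟨agree i hin _ (hU.proj_mem ha i) (PseudoComul.proj_mem 𝒜 i a),
        mem_posPart 𝒜 (by omega) (PseudoComul.proj_mem 𝒜 i a)⟩
    exact tmul_mem_tensorSub (aux _ h1 (by omega) a ha) (aux _ h2 (by omega) b hb)) hyU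
  exact key

theorem map_mem_tensorSq_of_agree (hΔ : IsPseudoComul 𝒜 Δ) {L U X : Subalgebra k A}
    (hU : Admissible 𝒜 Δ U) {n : ℕ} (hn : 1 ≤ n) (agree : ∀ i < n, ∀ a ∈ U, a ∈ 𝒜 i → a ∈ L)
    {z : A} (hz : z ∈ U) (hzn : z ∈ 𝒜 n) (hLX : L ≤ X) (hzX : z ∈ X) : Δ z ∈ tensorSq X := by
  have hle : Subalgebra.toSubmodule L ⊓ posPart 𝒜 ≤ Subalgebra.toSubmodule X :=
    inf_le_left.trans hLX
  have h := tensorSub_mono hle hle (primitive_mod_of_agree hΔ hU hn agree hz hzn)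
  have h2 := add_mem (mem_tensorSq.2 h) (add_mem (tmul_mem_tensorSq (one_mem X) hzX)
    (tmul_mem_tensorSq hzX (one_mem X)))
  simpa using h2

end Admissible

/-! ### Refining an interval of admissible subalgebras in one degree -/

section Levels

variable {k : Type u} [Field k] {A : Type v} [Ring A] [Algebra k A]
variable (𝒜 : ℕ → Submodule k A) [GradedAlgebra 𝒜] (Δ : A →ₐ[k] A ⊗[k] A)

/-- A pair `C, z` for which `C[z]` is an Ore extension of `C` by an element `z` of degree `d`
that is primitive modulo `C`. -/
structure IsStep (C : Subalgebra k A) (z : A) (d : ℕ) : Prop where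
  admissible : Admissible 𝒜 Δ C
  one_le : 1 ≤ d
  mem_deg : z ∈ 𝒜 d
  notMem : z ∉ C
  comm_mem : ∀ c ∈ C, z * c - c * z ∈ C
  exists_ambient : ∃ W : Subalgebra k A, Admissible 𝒜 Δ W ∧ C ≤ W ∧ z ∈ W ∧
    ∀ i < d, ∀ a ∈ W, a ∈ 𝒜 i → a ∈ C

/-- An interval of admissible subalgebras that agree in degrees below `n`. -/
structure IsInterval (n : ℕ) (L U : Subalgebra k A) : Prop where
  one_le : 1 ≤ n
  le : L ≤ U
  left : Admissible 𝒜 Δ L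
  right : Admissible 𝒜 Δ U
  agree : ∀ i < n, ∀ a ∈ U, a ∈ 𝒜 i → a ∈ L

variable {o : Type*} [LinearOrder o] (ρ : A → o)

/-- The span of `L` and the elements of `U` of degree `n` and rank less than that of `t`. -/
def levelSpace (n : ℕ) (L U : Subalgebra k A) (t : A) : Submodule k A :=
  Subalgebra.toSubmodule L ⊔ Submodule.span k {x | x ∈ U ∧ x ∈ 𝒜 n ∧ ρ x < ρ t}

/-- The largest admissible subalgebra of `U` whose part of degree `n` is in `levelSpace`. -/
def levelMax (n : ℕ) (L U : Subalgebra k A) (t : A) : Subalgebra k A :=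
  sSup {X | Admissible 𝒜 Δ X ∧ X ≤ U ∧ ∀ a ∈ X, proj 𝒜 n a ∈ levelSpace 𝒜 ρ n L U t}

/-- The subalgebra generated by `levelMax` and, if possible, the element `x`. -/
def levelAdjoin (n : ℕ) (L U : Subalgebra k A) (x : A) : Subalgebra k A :=
  levelMax 𝒜 Δ ρ n L U x ⊔ Algebra.adjoin k {y | y = x ∧ y ∈ U ∧ y ∈ 𝒜 n}

/-- The union of `L` and all the `levelAdjoin` of rank less than that of `t`. -/
def levelMin (n : ℕ) (L U : Subalgebra k A) (t : A) : Subalgebra k A :=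
  L ⊔ ⨆ x : {x : A // ρ x < ρ t}, levelAdjoin 𝒜 Δ ρ n L U x

/-- The steps `C ⊆ C[z]` obtained by iterated refinement of an interval. -/
inductive Leaf : ℕ → Subalgebra k A → Subalgebra k A → Subalgebra k A → A → ℕ → Prop
  | here (n : ℕ) (L U : Subalgebra k A) (x : A) (hU : x ∈ U) (hn : x ∈ 𝒜 n)
      (hx : x ∉ levelMax 𝒜 Δ ρ n L U x) : Leaf n L U (levelMax 𝒜 Δ ρ n L U x) x n
  | down (n : ℕ) (L U : Subalgebra k A) (t : A) (C : Subalgebra k A) (z : A) (d : ℕ)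
      (h : Leaf (n + 1) (levelMin 𝒜 Δ ρ n L U t) (levelMax 𝒜 Δ ρ n L U t) C z d) :
      Leaf n L U C z d

variable {𝒜 Δ ρ}

section Interval

variable {n : ℕ} {L U : Subalgebra k A}

/-- The elements of `U` whose component of degree `n` lies in `levelSpace` form a subalgebra. -/
theorem exists_levelSub (h : IsInterval 𝒜 Δ n L U)
    (connected : ∀ a, ∃ c : k, proj 𝒜 0 a = c • (1 : A))
    (t : A) : ∃ T : Subalgebra k A,
    ∀ a, a ∈ T ↔ a ∈ U ∧ proj 𝒜 n a ∈ levelSpace 𝒜 ρ n L U t := by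
  refine ⟨{ carrier := {a | a ∈ U ∧ proj 𝒜 n a ∈ levelSpace 𝒜 ρ n L U t}
            mul_mem' := ?_, add_mem' := ?_, algebraMap_mem' := ?_ }, fun a => Iff.rfl⟩
  · rintro a b ⟨ha, ha'⟩ ⟨hb, hb'⟩
    refine ⟨mul_mem ha hb, ?_⟩
    rw [proj_mul]
    refine Submodule.sum_mem _ fun p hp => ?_
    rw [Finset.HasAntidiagonal.mem_antidiagonal] at hp
    -- The two extreme terms are scalar multiples of the degree n components of a and b. All other
    -- factors have degree below n, hence lie in `L`.
    by_cases h1 : p.1 = 0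
    · obtain ⟨c, hc⟩ := connected a
      rw [h1, hc, smul_one_mul, show p.2 = n by omega]
      exact Submodule.smul_mem _ _ hb'
    by_cases h2 : p.2 = 0
    · obtain ⟨c, hc⟩ := connected b
      rw [h2, hc, mul_smul_one, show p.1 = n by omega]
      exact Submodule.smul_mem _ _ ha'
    · refine Submodule.mem_sup_left (mul_mem (S := Subalgebra k A) (s := L) ?_ ?_)
      · exact h.agree _ (by omega) _ (h.right.proj_mem ha _) (proj_mem 𝒜 _ _)
      · exact h.agree _ (by omega) _ (h.right.proj_mem hb _) (proj_mem 𝒜 _ _)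
  · rintro a b ⟨ha, ha'⟩ ⟨hb, hb'⟩
    exact ⟨add_mem ha hb, by rw [map_add]; exact add_mem ha' hb'⟩
  · intro r
    refine ⟨U.algebraMap_mem r, ?_⟩
    rw [proj_of_mem_ne 𝒜 (algebraMap_mem_zero 𝒜 r) (by have := h.one_le; omega)]
    exact Submodule.zero_mem _

theorem levelMax_spec (h : IsInterval 𝒜 Δ n L U)
    (connected : ∀ a, ∃ c : k, proj 𝒜 0 a = c • (1 : A))
    (t : A) : levelMax 𝒜 Δ ρ n L U t ≤ U ∧
    ∀ a ∈ levelMax 𝒜 Δ ρ n L U t, proj 𝒜 n a ∈ levelSpace 𝒜 ρ n L U t := by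
  obtain ⟨T, hT⟩ := exists_levelSub (ρ := ρ) h connected t
  have : levelMax 𝒜 Δ ρ n L U t ≤ T :=
    sSup_le fun X hX a ha => (hT a).2 ⟨hX.2.1 ha, hX.2.2 a ha⟩
  exact ⟨fun a ha => ((hT a).1 (this ha)).1, fun a ha => ((hT a).1 (this ha)).2⟩

/-- The form in which maximality is used: the elements satisfying the degree n condition form a
subalgebra, so an admissible algebra is tested on its generators. -/
theorem sup_adjoin_le_levelMax (h : IsInterval 𝒜 Δ n L U)
    (connected : ∀ a, ∃ c : k, proj 𝒜 0 a = c • (1 : A))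
    (t : A) {X : Subalgebra k A} {s : Set A}
    (hXs : Admissible 𝒜 Δ (X ⊔ Algebra.adjoin k s))
    (hX : ∀ a ∈ X, a ∈ U ∧ proj 𝒜 n a ∈ levelSpace 𝒜 ρ n L U t)
    (hs : ∀ a ∈ s, a ∈ U ∧ proj 𝒜 n a ∈ levelSpace 𝒜 ρ n L U t) :
    X ⊔ Algebra.adjoin k s ≤ levelMax 𝒜 Δ ρ n L U t := by
  obtain ⟨T, hT⟩ := exists_levelSub (ρ := ρ) h connected t
  have : X ⊔ Algebra.adjoin k s ≤ T :=
    sup_le (fun a ha => (hT a).2 (hX a ha)) (Algebra.adjoin_le fun a ha => (hT a).2 (hs a ha))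
  exact le_sSup ⟨hXs, fun a ha => ((hT a).1 (this ha)).1, fun a ha => ((hT a).1 (this ha)).2⟩

theorem levelMax_admissible (t : A) : Admissible 𝒜 Δ (levelMax 𝒜 Δ ρ n L U t) :=
  Admissible.sSup fun _ hX => hX.1

theorem le_levelMax (h : IsInterval 𝒜 Δ n L U) (t : A) : L ≤ levelMax 𝒜 Δ ρ n L U t :=
  le_sSup ⟨h.left, h.le, fun _ ha => Submodule.mem_sup_left (h.left.proj_mem ha n)⟩

theorem levelMax_mono {s t : A} (hst : ρ s ≤ ρ t) :
    levelMax 𝒜 Δ ρ n L U s ≤ levelMax 𝒜 Δ ρ n L U t :=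
  sSup_le_sSup fun _ hX => ⟨hX.1, hX.2.1, fun a ha =>
    (sup_le_sup le_rfl (Submodule.span_mono fun _ hx => ⟨hx.1, hx.2.1, hx.2.2.trans_le hst⟩) :
      levelSpace 𝒜 ρ n L U s ≤ levelSpace 𝒜 ρ n L U t) (hX.2.2 a ha)⟩

theorem adjoin_admissible (h : IsInterval 𝒜 Δ n L U) (hΔ : IsPseudoComul 𝒜 Δ)
    {X : Subalgebra k A} (hX : Admissible 𝒜 Δ X)
    (hLX : L ≤ X) {s : Set A} (hs : ∀ x ∈ s, x ∈ U ∧ x ∈ 𝒜 n) :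
    Admissible 𝒜 Δ (X ⊔ Algebra.adjoin k s) := by
  refine hX.sup_adjoin fun x hx => ?_
  have hxX : x ∈ X ⊔ Algebra.adjoin k s :=
    (le_sup_right : _ ≤ X ⊔ Algebra.adjoin k s) (Algebra.subset_adjoin hx)
  refine ⟨fun i => ?_, map_mem_tensorSq_of_agree hΔ h.right h.one_le h.agree (hs x hx).1
    (hs x hx).2 (hLX.trans le_sup_left) hxX⟩
  by_cases hi : n = i
  · subst hi; rwa [proj_of_mem 𝒜 (hs x hx).2]
  · rw [proj_of_mem_ne 𝒜 (hs x hx).2 hi]; exact zero_mem _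

theorem mem_levelMax (h : IsInterval 𝒜 Δ n L U)
    (connected : ∀ a, ∃ c : k, proj 𝒜 0 a = c • (1 : A))
    (hΔ : IsPseudoComul 𝒜 Δ) {x t : A} (hU : x ∈ U) (hn : x ∈ 𝒜 n)
    (hxt : ρ x < ρ t) : x ∈ levelMax 𝒜 Δ ρ n L U t := by
  have hs : ∀ y ∈ ({x} : Set A), y ∈ U ∧ y ∈ 𝒜 n := by rintro _ rfl; exact ⟨hU, hn⟩
  refine sup_adjoin_le_levelMax h connected t (adjoin_admissible h hΔ h.left le_rfl hs)
    (fun a ha => ⟨h.le ha, Submodule.mem_sup_left (h.left.proj_mem ha n)⟩) ?_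
    ((le_sup_right : _ ≤ L ⊔ Algebra.adjoin k {x}) (Algebra.subset_adjoin rfl))
  rintro _ rfl
  refine ⟨hU, ?_⟩
  rw [proj_of_mem 𝒜 hn]
  exact Submodule.mem_sup_right (Submodule.subset_span ⟨hU, hn, hxt⟩)

/-- Giving 0 the top rank makes every nonzero element of U_n count at t = 0, so the levels exhaust U
without an extra top index. -/
theorem levelMax_eq_of_forall_le (h : IsInterval 𝒜 Δ n L U)
    (connected : ∀ a, ∃ c : k, proj 𝒜 0 a = c • (1 : A))
    (h0 : ∀ x, ρ x ≤ ρ 0)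
    (hρ : Function.Injective ρ) : levelMax 𝒜 Δ ρ n L U 0 = U := by
  refine le_antisymm (levelMax_spec h connected 0).1 (le_sSup ⟨h.right, le_rfl, fun a ha => ?_⟩)
  by_cases hz : proj 𝒜 n a = 0
  · rw [hz]; exact zero_mem _
  · exact Submodule.mem_sup_right (Submodule.subset_span ⟨h.right.proj_mem ha n,
      proj_mem 𝒜 n a, lt_of_le_of_ne (h0 _) fun e => hz (hρ e)⟩)

theorem levelAdjoin_admissible (h : IsInterval 𝒜 Δ n L U) (hΔ : IsPseudoComul 𝒜 Δ) (x : A) :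
    Admissible 𝒜 Δ (levelAdjoin 𝒜 Δ ρ n L U x) :=
  adjoin_admissible h hΔ (levelMax_admissible x) (le_levelMax h x) fun _ hy => hy.2

theorem levelAdjoin_le_levelMax (h : IsInterval 𝒜 Δ n L U)
    (connected : ∀ a, ∃ c : k, proj 𝒜 0 a = c • (1 : A))
    (hΔ : IsPseudoComul 𝒜 Δ) {x t : A} (hxt : ρ x < ρ t) :
    levelAdjoin 𝒜 Δ ρ n L U x ≤ levelMax 𝒜 Δ ρ n L U t := by
  refine sup_le (levelMax_mono hxt.le) (Algebra.adjoin_le ?_)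
  rintro _ ⟨rfl, hU, hn⟩
  exact mem_levelMax h connected hΔ hU hn hxt

theorem levelAdjoin_le_levelMin {x t : A} (hxt : ρ x < ρ t) :
    levelAdjoin 𝒜 Δ ρ n L U x ≤ levelMin 𝒜 Δ ρ n L U t :=
  le_sup_of_le_right (le_iSup (fun x : {x : A // ρ x < ρ t} => levelAdjoin 𝒜 Δ ρ n L U x) ⟨x, hxt⟩)

theorem levelMax_le_levelMin {x t : A} (hxt : ρ x < ρ t) :
    levelMax 𝒜 Δ ρ n L U x ≤ levelMin 𝒜 Δ ρ n L U t :=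
  le_sup_left.trans (levelAdjoin_le_levelMin hxt)

theorem mem_levelMin (h : IsInterval 𝒜 Δ n L U)
    (connected : ∀ a, ∃ c : k, proj 𝒜 0 a = c • (1 : A))
    (hΔ : IsPseudoComul 𝒜 Δ) (hρ : Function.Injective ρ) {a t : A}
    (ha : a ∈ levelMin 𝒜 Δ ρ n L U t) :
    a ∈ L ∨ ∃ x, ρ x < ρ t ∧ a ∈ levelAdjoin 𝒜 Δ ρ n L U x := by
  by_cases hne : Nonempty {x : A // ρ x < ρ t}
  · right
    have hL : levelMin 𝒜 Δ ρ n L U t =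
        ⨆ x : {x : A // ρ x < ρ t}, levelAdjoin 𝒜 Δ ρ n L U x := by
      refine sup_eq_right.2 ?_
      obtain ⟨x⟩ := hne
      exact ((le_levelMax h x.1).trans le_sup_left).trans
        (le_iSup (fun x : {x : A // ρ x < ρ t} => levelAdjoin 𝒜 Δ ρ n L U x) x)
    rw [hL] at ha
    have hdir : Directed (· ≤ ·)
        (fun x : {x : A // ρ x < ρ t} => levelAdjoin 𝒜 Δ ρ n L U x.1) := by
      have aux : ∀ x y : A, ρ x < ρ y →
          levelAdjoin 𝒜 Δ ρ n L U x ≤ levelAdjoin 𝒜 Δ ρ n L U y := fun x y hxy =>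
        (levelAdjoin_le_levelMax h connected hΔ hxy).trans le_sup_left
      intro x y
      rcases lt_trichotomy (ρ x.1) (ρ y.1) with hxy | hxy | hxy
      · exact ⟨y, aux _ _ hxy, le_rfl⟩
      · exact ⟨x, le_rfl, (congrArg (levelAdjoin 𝒜 Δ ρ n L U) (hρ hxy)).ge⟩
      · exact ⟨x, le_rfl, aux _ _ hxy⟩
    rw [← SetLike.mem_coe, Subalgebra.coe_iSup_of_directed hdir] at ha
    obtain ⟨x, hx⟩ := Set.mem_iUnion.1 ha
    exact ⟨x.1, x.2, hx⟩
  · left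
    have : IsEmpty {x : A // ρ x < ρ t} := not_nonempty_iff.1 hne
    simpa [levelMin] using ha

/-- In degree n the upper end lies in L plus the span of the elements x of U_n with smaller rank,
and each such x was adjoined to the lower end. The gap can therefore be refined one degree higher.
-/
theorem IsInterval.child (h : IsInterval 𝒜 Δ n L U)
    (connected : ∀ a, ∃ c : k, proj 𝒜 0 a = c • (1 : A))
    (hΔ : IsPseudoComul 𝒜 Δ) (t : A) :
    IsInterval 𝒜 Δ (n + 1) (levelMin 𝒜 Δ ρ n L U t) (levelMax 𝒜 Δ ρ n L U t) where
  one_le := by omega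
  le := sup_le (le_levelMax h t) (iSup_le fun x => levelAdjoin_le_levelMax h connected hΔ x.2)
  left := h.left.sup (Admissible.iSup fun x => levelAdjoin_admissible h hΔ x.1)
  right := levelMax_admissible t
  agree i hi a ha hai := by
    rcases (Nat.lt_succ_iff_lt_or_eq.1 hi) with hi | rfl
    · exact (le_sup_left : L ≤ _) (h.agree i hi a ((levelMax_spec h connected t).1 ha) hai)
    · have := (levelMax_spec h connected t).2 a ha
      rw [proj_of_mem 𝒜 hai] at this
      refine (sup_le ?_ (Submodule.span_le.2 ?_) : levelSpace 𝒜 ρ i L U t ≤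
        Subalgebra.toSubmodule (levelMin 𝒜 Δ ρ i L U t)) this
      · exact (le_sup_left : L ≤ levelMin 𝒜 Δ ρ i L U t)
      · rintro x ⟨hxU, hxn, hxt⟩
        exact levelAdjoin_le_levelMin hxt
          ((le_sup_right : _ ≤ levelAdjoin 𝒜 Δ ρ i L U x) (Algebra.subset_adjoin ⟨rfl, hxU, hxn⟩))

/-- Adjoining the commutators to C keeps it admissible and adds nothing in degree n, so maximality
of C forces them into C. -/
theorem comm_mem_levelMax (h : IsInterval 𝒜 Δ n L U)
    (connected : ∀ a, ∃ c : k, proj 𝒜 0 a = c • (1 : A))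
    (hΔ : IsPseudoComul 𝒜 Δ) {z t c : A} (hz : z ∈ U) (hzn : z ∈ 𝒜 n)
    (hc : c ∈ levelMax 𝒜 Δ ρ n L U t) : z * c - c * z ∈ levelMax 𝒜 Δ ρ n L U t := by
  set C := levelMax 𝒜 Δ ρ n L U t with hC
  have hCadm : Admissible 𝒜 Δ C := levelMax_admissible t
  have hLC : L ≤ C := le_levelMax h t
  let s : Set A := {w | ∃ c ∈ C, w = z * c - c * z}
  set X := C ⊔ Algebra.adjoin k s with hX
  have hCX : C ≤ X := le_sup_left
  have hsX : ∀ c ∈ C, z * c - c * z ∈ X := fun c hc =>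
    (le_sup_right : Algebra.adjoin k s ≤ X) (Algebra.subset_adjoin ⟨c, hc, rfl⟩)
  have hXadm : Admissible 𝒜 Δ X := by
    refine hCadm.sup_adjoin ?_
    rintro _ ⟨c, hc, rfl⟩
    constructor
    · intro i
      by_cases hi : n ≤ i
      · obtain ⟨j, rfl⟩ := Nat.exists_eq_add_of_le hi
        rw [map_sub, proj_mul_of_mem_left 𝒜 hzn, add_comm, proj_mul_of_mem_right 𝒜 hzn]
        exact hsX _ (hCadm.proj_mem hc j)
      · rw [map_sub, GradedAlgebra.proj_apply, GradedAlgebra.proj_apply,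
          DirectSum.coe_decompose_mul_of_left_mem_of_not_le 𝒜 hzn hi,
          DirectSum.coe_decompose_mul_of_right_mem_of_not_le 𝒜 hzn hi, sub_zero]
        exact zero_mem _
    · have hp : Δ z - (1 ⊗ₜ[k] z + z ⊗ₜ[k] 1) ∈ tensorSq C :=
        mem_tensorSq.2 (tensorSub_mono (inf_le_left.trans hLC) (inf_le_left.trans hLC)
          (primitive_mod_of_agree hΔ h.right h.one_le h.agree hz hzn))
      have hy := hCadm.map_mem hc
      set e : A ⊗[k] A := 1 ⊗ₜ[k] z + z ⊗ₜ[k] 1 with he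
      -- Bracketing with the primitive part of Δ(z) acts as ad z on each tensor factor. The
      -- remaining part of Δ(z) lies in C ⊗ C and brackets into C ⊗ C.
      have key : e * Δ c - Δ c * e ∈ tensorSq X := by
        refine tensorSq_induction ((Subalgebra.toSubmodule (tensorSq X)).comap
          (LinearMap.mulLeft k e - LinearMap.mulRight k e)) (fun a ha b hb => ?_) hy
        have : (LinearMap.mulLeft k e - LinearMap.mulRight k e) (a ⊗ₜ[k] b) =
            a ⊗ₜ[k] (z * b - b * z) + (z * a - a * z) ⊗ₜ[k] b := by
          simp only [LinearMap.sub_apply, LinearMap.mulLeft_apply, LinearMap.mulRight_apply, he,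
            add_mul, mul_add, Algebra.TensorProduct.tmul_mul_tmul, one_mul, mul_one,
            TensorProduct.tmul_sub, TensorProduct.sub_tmul]
          abel
        rw [Submodule.mem_comap, this]
        exact add_mem (S := Subalgebra k _) (s := tensorSq X)
          (tmul_mem_tensorSq (hCX ha) (hsX b hb)) (tmul_mem_tensorSq (hsX a ha) (hCX hb))
      have : Δ (z * c - c * z) =
          (e * Δ c - Δ c * e) + ((Δ z - e) * Δ c - Δ c * (Δ z - e)) := by
        rw [map_sub, map_mul, map_mul]; noncomm_ring
      rw [this]
      exact add_mem key (tensorSq_mono hCX (sub_mem (mul_mem hp hy) (mul_mem hy hp)))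
  have hspec := levelMax_spec (ρ := ρ) h connected t
  have : X ≤ C := by
    refine sup_adjoin_le_levelMax h connected t hXadm
      (fun a ha => ⟨hspec.1 ha, hspec.2 a ha⟩) ?_
    rintro _ ⟨c, hc, rfl⟩
    refine ⟨sub_mem (mul_mem hz (hspec.1 hc)) (mul_mem (hspec.1 hc) hz), ?_⟩
    -- As z has degree n, the degree n component of [z, c] involves only the scalar component of c,
    -- with which z commutes.
    obtain ⟨r, hr⟩ := connected c
    have h1 := proj_mul_of_mem_left 𝒜 hzn 0 c
    have h2 := proj_mul_of_mem_right 𝒜 hzn 0 c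
    rw [add_zero] at h1
    rw [zero_add] at h2
    rw [map_sub, h1, h2, hr, smul_one_mul, mul_smul_one, sub_self]
    exact zero_mem _
  exact this (hsX c hc)

end Interval

end Levels

/-! ### The steps of the iterated refinement and their order -/

section Leaves

variable {k : Type u} [Field k] {A : Type v} [Ring A] [Algebra k A]
variable {𝒜 : ℕ → Submodule k A} [GradedAlgebra 𝒜] {Δ : A →ₐ[k] A ⊗[k] A}
variable {o : Type*} [LinearOrder o] {ρ : A → o}

theorem levelAdjoin_eq {n : ℕ} {L U : Subalgebra k A} {x : A} (hU : x ∈ U) (hn : x ∈ 𝒜 n) :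
    levelAdjoin 𝒜 Δ ρ n L U x = levelMax 𝒜 Δ ρ n L U x ⊔ Algebra.adjoin k {x} := by
  have : {y | y = x ∧ y ∈ U ∧ y ∈ 𝒜 n} = ({x} : Set A) := by
    ext y; constructor
    · exact fun hy => hy.1
    · rintro rfl; exact ⟨rfl, hU, hn⟩
  rw [levelAdjoin, this]

theorem Leaf.spec (hΔ : IsPseudoComul 𝒜 Δ) (connected : ∀ a, ∃ c : k, proj 𝒜 0 a = c • (1 : A))
    {n : ℕ} {L U C : Subalgebra k A} {z : A} {d : ℕ} (hl : Leaf 𝒜 Δ ρ n L U C z d)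
    (h : IsInterval 𝒜 Δ n L U) :
    IsStep 𝒜 Δ C z d ∧ L ≤ C ∧ C ⊔ Algebra.adjoin k {z} ≤ U ∧ n ≤ d := by
  induction hl with
  | here n L U x hU hn hx =>
    have hle := (levelMax_spec (ρ := ρ) h connected x).1
    refine ⟨⟨levelMax_admissible x, h.one_le, hn, hx,
      fun c hc => comm_mem_levelMax h connected hΔ hU hn hc, U, h.right, hle, hU,
      fun i hi a ha hai => le_levelMax h x (h.agree i hi a ha hai)⟩, le_levelMax h x,
      sup_le hle (Algebra.adjoin_le ?_), le_rfl⟩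
    rintro _ rfl; exact hU
  | down n L U t C z d hl ih =>
    obtain ⟨h1, h2, h3, h4⟩ := ih (h.child connected hΔ t)
    exact ⟨h1, le_sup_left.trans h2, h3.trans (levelMax_spec h connected t).1, by omega⟩

/-- Two steps in a refinement are equal, or one of them lies entirely below the other. -/
theorem Leaf.separated (hΔ : IsPseudoComul 𝒜 Δ)
    (connected : ∀ a, ∃ c : k, proj 𝒜 0 a = c • (1 : A)) (hρ : Function.Injective ρ)
    {n : ℕ} {L U C : Subalgebra k A} {z : A} {d : ℕ} (hl : Leaf 𝒜 Δ ρ n L U C z d)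
    (h : IsInterval 𝒜 Δ n L U) {C' : Subalgebra k A} {z' : A} {d' : ℕ}
    (hl' : Leaf 𝒜 Δ ρ n L U C' z' d') :
    (C = C' ∧ z = z' ∧ d = d') ∨ C ⊔ Algebra.adjoin k {z} ≤ C' ∨
      C' ⊔ Algebra.adjoin k {z'} ≤ C := by
  -- A step at x in degree n against one found inside the gap at t: it precedes the gap if x has
  -- smaller rank than t. Otherwise the whole gap lies below `levelMax` at x, even when x = t.
  have mixed : ∀ {n : ℕ} {L U : Subalgebra k A} (_ : IsInterval 𝒜 Δ n L U) {x t : A}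
      (_ : x ∈ U) (_ : x ∈ 𝒜 n) {C : Subalgebra k A} {z : A} {d : ℕ}
      (_ : Leaf 𝒜 Δ ρ (n + 1) (levelMin 𝒜 Δ ρ n L U t) (levelMax 𝒜 Δ ρ n L U t) C z d),
      levelMax 𝒜 Δ ρ n L U x ⊔ Algebra.adjoin k {x} ≤ C ∨
        C ⊔ Algebra.adjoin k {z} ≤ levelMax 𝒜 Δ ρ n L U x := by
    intro n L U h x t hU hn C z d hl
    obtain ⟨-, h2, h3, -⟩ := hl.spec hΔ connected (h.child connected hΔ t)
    rcases lt_or_ge (ρ x) (ρ t) with hxt | hxt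
    · left
      rw [← levelAdjoin_eq hU hn]
      exact (levelAdjoin_le_levelMin hxt).trans h2
    · exact Or.inr (h3.trans (levelMax_mono hxt))
  induction hl generalizing C' z' d' with
  | here n L U x hU hn hx =>
    cases hl' with
    | here _ _ _ y hU' hn' hx' =>
      rcases lt_trichotomy (ρ x) (ρ z') with hxy | hxy | hxy
      · right; left
        rw [← levelAdjoin_eq hU hn]
        exact levelAdjoin_le_levelMax h connected hΔ hxy
      · have := hρ hxy
        subst this
        exact Or.inl ⟨rfl, rfl, rfl⟩
      · right; right
        rw [← levelAdjoin_eq hU' hn']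
        exact levelAdjoin_le_levelMax h connected hΔ hxy
    | down _ _ _ t _ _ _ hl' => exact Or.inr (mixed h hU hn hl')
  | down n L U t C z d hl ih =>
    cases hl' with
    | here _ _ _ y hU' hn' hx' => exact Or.inr (mixed h hU' hn' hl).symm
    | down _ _ _ t' _ _ _ hl' =>
      have hc := h.child (ρ := ρ) connected hΔ
      obtain ⟨-, h2, h3, -⟩ := hl.spec hΔ connected (hc t)
      obtain ⟨-, h2', h3', -⟩ := hl'.spec hΔ connected (hc t')
      rcases lt_trichotomy (ρ t) (ρ t') with hxy | hxy | hxy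
      · exact Or.inr (Or.inl (h3.trans ((levelMax_le_levelMin hxy).trans h2')))
      · have := hρ hxy
        subst this
        exact ih (hc t) hl'
      · exact Or.inr (Or.inr (h3'.trans ((levelMax_le_levelMin hxy).trans h2)))

/-- Every homogeneous element of `U` outside `L` is captured by some step. -/
theorem exists_leaf [WellFoundedLT o] (hΔ : IsPseudoComul 𝒜 Δ)
    (connected : ∀ a, ∃ c : k, proj 𝒜 0 a = c • (1 : A)) (hρ : Function.Injective ρ)
    (h0 : ∀ x, ρ x ≤ ρ 0) {m : ℕ} {a : A} (ha : a ∈ 𝒜 m) (j : ℕ) :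
    ∀ {n : ℕ} {L U : Subalgebra k A}, IsInterval 𝒜 Δ n L U → m + 1 ≤ n + j → a ∈ U → a ∉ L →
      ∃ C z d, Leaf 𝒜 Δ ρ n L U C z d ∧ a ∈ C ⊔ Algebra.adjoin k {z} ∧ a ∉ C := by
  induction j with
  | zero => exact fun h hm hU hL => absurd (h.agree m (by omega) a hU ha) hL
  | succ j ih =>
    intro n L U h hm hU hL
    -- Take the least t whose level contains a. Either a already lies in some `levelAdjoin` at
    -- smaller x, and the step at x captures it, or a lies in the gap at t and is found by
    -- recursion.
    have hex : ∃ q, ∃ t, ρ t = q ∧ a ∈ levelMax 𝒜 Δ ρ n L U t :=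
      ⟨ρ 0, 0, rfl, by rwa [levelMax_eq_of_forall_le h connected h0 hρ]⟩
    obtain ⟨t, ht, hat⟩ := WellFounded.min_mem (wellFounded_lt (α := o)) {q | ∃ t, ρ t = q ∧
      a ∈ levelMax 𝒜 Δ ρ n L U t} hex
    have hmin : ∀ x, ρ x < ρ t → a ∉ levelMax 𝒜 Δ ρ n L U x := fun x hx hax =>
      WellFounded.not_lt_min (wellFounded_lt (α := o)) {q | ∃ t, ρ t = q ∧
        a ∈ levelMax 𝒜 Δ ρ n L U t} (show ρ x ∈ _ from ⟨x, rfl, hax⟩) (ht ▸ hx)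
    by_cases haL : a ∈ levelMin 𝒜 Δ ρ n L U t
    · obtain hl | ⟨x, hxt, hax⟩ := mem_levelMin h connected hΔ hρ haL
      · exact absurd hl hL
      have hE := hmin x hxt
      have hxU : x ∈ U ∧ x ∈ 𝒜 n ∧ x ∉ levelMax 𝒜 Δ ρ n L U x := by
        by_contra hcon
        apply hE
        refine (sup_le le_rfl (Algebra.adjoin_le ?_) : levelAdjoin 𝒜 Δ ρ n L U x ≤ _) hax
        rintro _ ⟨rfl, h1, h2⟩
        by_contra h3
        exact hcon ⟨h1, h2, h3⟩
      rw [levelAdjoin_eq hxU.1 hxU.2.1] at hax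
      exact ⟨_, x, n, Leaf.here n L U x hxU.1 hxU.2.1 hxU.2.2, hax, hE⟩
    · obtain ⟨C, z, d, hl, h1, h2⟩ := ih (h.child connected hΔ t) (by omega) hat haL
      exact ⟨C, z, d, Leaf.down n L U t C z d hl, h1, h2⟩

/-- The steps of bounded degree are well-ordered. -/
theorem Leaf.exists_min [WellFoundedLT o] (hΔ : IsPseudoComul 𝒜 Δ)
    (connected : ∀ a, ∃ c : k, proj 𝒜 0 a = c • (1 : A)) (hρ : Function.Injective ρ) (m j : ℕ) :
    ∀ {n : ℕ} {L U : Subalgebra k A}, IsInterval 𝒜 Δ n L U → m + 1 ≤ n + j →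
      ∀ S : Set (Subalgebra k A), S.Nonempty →
      (∀ C ∈ S, ∃ z d, d ≤ m ∧ Leaf 𝒜 Δ ρ n L U C z d) → ∃ C ∈ S, ∀ C' ∈ S, C ≤ C' := by
  induction j with
  | zero =>
    rintro n L U h hm S ⟨C, hC⟩ hS
    obtain ⟨z, d, hd, hl⟩ := hS C hC
    have := (hl.spec hΔ connected h).2.2.2
    omega
  | succ j ih =>
    rintro n L U h hm S ⟨C₀, hC₀⟩ hS
    have hc := h.child (ρ := ρ) connected hΔ
    -- Steps are grouped by rank: those inside the gap at t, followed by the step at t itself, whose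
    -- lower algebra is the top of that gap. The minimum is sought in the first group that occurs,
    -- by recursion in the gap if possible.
    let IsAt (t : A) (C : Subalgebra k A) : Prop :=
      (∃ z d, d ≤ m ∧ Leaf 𝒜 Δ ρ (n + 1) (levelMin 𝒜 Δ ρ n L U t) (levelMax 𝒜 Δ ρ n L U t) C z d)
        ∨ C = levelMax 𝒜 Δ ρ n L U t
    have hAt : ∀ C ∈ S, ∃ t, IsAt t C := by
      intro C hC
      obtain ⟨z, d, hd, hl⟩ := hS C hC
      cases hl with
      | here _ _ _ y hU' hn' hx' => exact ⟨z, Or.inr rfl⟩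
      | down _ _ _ t _ _ _ hl => exact ⟨t, Or.inl ⟨z, d, hd, hl⟩⟩
    have bounds : ∀ t C, IsAt t C → (L ≤ C ∧ C ≤ levelMax 𝒜 Δ ρ n L U t) ∧
        ∀ x, ρ x < ρ t → levelMax 𝒜 Δ ρ n L U x ≤ C := by
      rintro t C (⟨z, d, hd, hl⟩ | rfl)
      · obtain ⟨-, h2, h3, -⟩ := hl.spec hΔ connected (hc t)
        exact ⟨⟨le_sup_left.trans h2, le_sup_left.trans h3⟩,
          fun x hx => (levelMax_le_levelMin hx).trans h2⟩
      · exact ⟨⟨le_levelMax h t, le_rfl⟩, fun x hx => levelMax_mono hx.le⟩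
    let Q : Set o := {q | ∃ t, ρ t = q ∧ ∃ C ∈ S, IsAt t C}
    have hQ : Q.Nonempty := by
      obtain ⟨t, ht⟩ := hAt C₀ hC₀
      exact ⟨ρ t, t, rfl, C₀, hC₀, ht⟩
    obtain ⟨t, ht, C₁, hC₁, hC₁t⟩ := WellFounded.min_mem (wellFounded_lt (α := o)) Q hQ
    have hmin : ∀ s, ∀ C ∈ S, IsAt s C → s = t ∨ levelMax 𝒜 Δ ρ n L U t ≤ C := by
      intro s C hC hs
      have h1 : ρ t ≤ ρ s := by
        rw [ht]
        exact not_lt.1 (WellFounded.not_lt_min (wellFounded_lt (α := o)) Q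
          (show ρ s ∈ Q from ⟨s, rfl, C, hC, hs⟩))
      rcases h1.eq_or_lt with h1 | h1
      · exact Or.inl (hρ h1.symm)
      · exact Or.inr ((bounds s C hs).2 t h1)
    let S' : Set (Subalgebra k A) := {C | C ∈ S ∧ ∃ z d, d ≤ m ∧
      Leaf 𝒜 Δ ρ (n + 1) (levelMin 𝒜 Δ ρ n L U t) (levelMax 𝒜 Δ ρ n L U t) C z d}
    by_cases hS' : S'.Nonempty
    · obtain ⟨C, hC, hCmin⟩ := ih (hc t) (by omega) S' hS' fun C hC => hC.2
      refine ⟨C, hC.1, fun C' hC' => ?_⟩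
      have hCle := (bounds t C (Or.inl hC.2)).1.2
      obtain ⟨s, hs⟩ := hAt C' hC'
      rcases hmin s C' hC' hs with rfl | hle
      · rcases hs with hs | rfl
        · exact hCmin C' ⟨hC', hs⟩
        · exact hCle
      · exact hCle.trans hle
    · refine ⟨C₁, hC₁, fun C' hC' => ?_⟩
      obtain ⟨s, hs⟩ := hAt C' hC'
      rcases hmin s C' hC' hs with rfl | hle
      · rcases hs with hs | rfl
        · exact absurd ⟨C', hC', hs⟩ hS'
        · exact (bounds s C₁ hC₁t).1.2
      · exact (bounds t C₁ hC₁t).1.2.trans hle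

end Leaves

/-! ### A single step: the derivation in z and the filtration by powers of z -/

section Step

variable {k : Type u} [Field k] {A : Type v} [Ring A] [Algebra k A]
variable {𝒜 : ℕ → Submodule k A} [GradedAlgebra 𝒜] {Δ : A →ₐ[k] A ⊗[k] A}

theorem mem_sup_adjoin (C : Subalgebra k A) (z : A) : z ∈ C ⊔ Algebra.adjoin k {z} :=
  (le_sup_right : _ ≤ C ⊔ Algebra.adjoin k {z}) (Algebra.subset_adjoin rfl)

theorem IsStep.adjoin_admissible {C : Subalgebra k A} {z : A} {d : ℕ} (h : IsStep 𝒜 Δ C z d)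
    (hΔ : IsPseudoComul 𝒜 Δ) : Admissible 𝒜 Δ (C ⊔ Algebra.adjoin k {z}) := by
  obtain ⟨W, hW, hCW, hzW, hag⟩ := h.exists_ambient
  refine PseudoComul.adjoin_admissible (n := d) (L := C) (U := W)
    ⟨h.one_le, hCW, h.admissible, hW, hag⟩
    hΔ h.admissible le_rfl ?_
  rintro _ rfl; exact ⟨hzW, h.mem_deg⟩

theorem IsStep.mem_of_lt {C : Subalgebra k A} {z : A} {d : ℕ} (h : IsStep 𝒜 Δ C z d)
    {i : ℕ} (hi : i < d) {a : A} (ha : a ∈ C ⊔ Algebra.adjoin k {z}) (hai : a ∈ 𝒜 i) : a ∈ C := by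
  obtain ⟨W, hW, hCW, hzW, hag⟩ := h.exists_ambient
  refine hag i hi a ((sup_le hCW (Algebra.adjoin_le ?_) : _ ≤ W) ha) hai
  rintro _ rfl; exact hzW

theorem IsStep.primitive_mod {C : Subalgebra k A} {z : A} {d : ℕ} (h : IsStep 𝒜 Δ C z d)
    (hΔ : IsPseudoComul 𝒜 Δ) : Δ z - (1 ⊗ₜ[k] z + z ⊗ₜ[k] 1) ∈
      tensorSub (Subalgebra.toSubmodule C ⊓ posPart 𝒜) (Subalgebra.toSubmodule C ⊓ posPart 𝒜) := by
  obtain ⟨W, hW, hCW, hzW, hag⟩ := h.exists_ambient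
  exact primitive_mod_of_agree hΔ hW h.one_le hag hzW h.mem_deg

/-- Contraction of the second tensor factor with a linear functional. -/
def contract (f : A →ₗ[k] k) : A ⊗[k] A →ₗ[k] A :=
  (TensorProduct.rid k A).toLinearMap ∘ₗ LinearMap.lTensor A f

theorem contract_tmul (f : A →ₗ[k] k) (a b : A) : contract f (a ⊗ₜ[k] b) = f b • a := by
  simp [contract]

theorem counit_one [Nontrivial A] {ε : A →ₗ[k] k} (hε : ∀ a, proj 𝒜 0 a = ε a • (1 : A)) :
    ε 1 = 1 := by
  have h1 := hε 1
  rw [proj_of_mem 𝒜 (one_mem_zero 𝒜), ← Algebra.algebraMap_eq_smul_one,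
    ← (algebraMap k A).map_one] at h1
  simpa using (FaithfulSMul.algebraMap_injective k A h1).symm

theorem counit_eq_zero [Nontrivial A] {ε : A →ₗ[k] k} (hε : ∀ a, proj 𝒜 0 a = ε a • (1 : A))
    {a : A} (ha : proj 𝒜 0 a = 0) : ε a = 0 := by
  have h1 := hε a
  rw [ha] at h1
  exact (smul_eq_zero.1 h1.symm).resolve_right one_ne_zero

/-- The counit kills A₊, so in positive degree only the term a ⊗ 1 survives. This one-sided counit
law is what replaces coassociativity in the Leibniz rule. -/
theorem contract_counit_comul [Nontrivial A] (hΔ : IsPseudoComul 𝒜 Δ) {ε : A →ₗ[k] k}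
    (hε : ∀ a, proj 𝒜 0 a = ε a • (1 : A)) (a : A) : contract ε (Δ a) = a := by
  have hom : ∀ n, ∀ a ∈ 𝒜 n, contract ε (Δ a) = a := by
    intro n a ha
    rcases Nat.eq_zero_or_pos n with rfl | hn
    · have h1 := hε a
      rw [proj_of_mem 𝒜 ha] at h1
      rw [h1, map_smul, map_smul, map_one, Algebra.TensorProduct.one_def, contract_tmul,
        counit_one hε, one_smul]
    · have h1 : tensorSub (posPart 𝒜) (posPart 𝒜) ≤ LinearMap.ker (contract ε) :=
        tensorSub_le fun a _ b hb => by
          rw [LinearMap.mem_ker, contract_tmul, counit_eq_zero hε (posPart_proj_zero 𝒜 hb),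
            zero_smul]
      have h2 := LinearMap.mem_ker.1 (h1 (hΔ.primitive_mod n hn a ha).1)
      rw [map_sub, map_add, contract_tmul, contract_tmul, counit_one hε,
        counit_eq_zero hε (proj_of_mem_ne 𝒜 ha (by omega)), zero_smul, one_smul, zero_add,
        sub_eq_zero] at h2
      exact h2
  have : a ∈ LinearMap.eqLocus (contract ε ∘ₗ Δ.toLinearMap) LinearMap.id :=
    mem_of_proj_mem 𝒜 (LinearMap.eqLocus (contract ε ∘ₗ Δ.toLinearMap)
      LinearMap.id).toAddSubmonoid fun i => hom i _ (proj_mem 𝒜 i a)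
  exact this

/-- The partial derivative with respect to `z` on `C[z]`. -/
theorem IsStep.exists_deriv [Nontrivial A] {C : Subalgebra k A} {z : A} {d : ℕ}
    (h : IsStep 𝒜 Δ C z d) (hΔ : IsPseudoComul 𝒜 Δ) {ε : A →ₗ[k] k}
    (hε : ∀ a, proj 𝒜 0 a = ε a • (1 : A)) :
    ∃ D : A →ₗ[k] A, (∀ c ∈ C, D c = 0) ∧ D z = 1 ∧
      ∀ a ∈ C ⊔ Algebra.adjoin k {z}, ∀ b ∈ C ⊔ Algebra.adjoin k {z},
        D (a * b) = D a * b + a * D b := by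
  have hd := h.one_le
  obtain ⟨g, hgz, hg⟩ := Submodule.exists_le_ker_of_notMem (p := Subalgebra.toSubmodule C) h.notMem
  -- On C[z] this f is an ε-derivation: in the degree d component of a product, the terms with both
  -- degrees positive are products of elements of C, where g vanishes.
  let f : A →ₗ[k] k := (g z)⁻¹ • (g ∘ₗ proj 𝒜 d)
  have hf : ∀ a, f a = (g z)⁻¹ * g (proj 𝒜 d a) := fun a => rfl
  have hfC : ∀ c ∈ C, f c = 0 := fun c hc => by
    rw [hf, LinearMap.mem_ker.1 (hg (h.admissible.proj_mem hc d)), mul_zero]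
  have hfz : f z = 1 := by rw [hf, proj_of_mem 𝒜 h.mem_deg, inv_mul_cancel₀ hgz]
  set E := C ⊔ Algebra.adjoin k {z} with hE
  have hEadm : Admissible 𝒜 Δ E := h.adjoin_admissible hΔ
  have hfmul : ∀ a ∈ E, ∀ b ∈ E, f (a * b) = f a * ε b + ε a * f b := by
    intro a ha b hb
    have h0d : ((0, d) : ℕ × ℕ) ∈ Finset.HasAntidiagonal.antidiagonal d := by simp
    have hd0 : ((d, 0) : ℕ × ℕ) ∈ (Finset.HasAntidiagonal.antidiagonal d).erase (0, d) := by
      simp; omega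
    rw [hf, proj_mul, ← Finset.add_sum_erase _ _ h0d, ← Finset.add_sum_erase _ _ hd0]
    have hrest : ∑ p ∈ ((Finset.HasAntidiagonal.antidiagonal d).erase (0, d)).erase (d, 0),
        proj 𝒜 p.1 a * proj 𝒜 p.2 b ∈ C := by
      refine sum_mem fun p hp => ?_
      simp only [Finset.mem_erase, Finset.HasAntidiagonal.mem_antidiagonal, ne_eq,
        Prod.ext_iff] at hp
      exact mul_mem (h.mem_of_lt (by omega) (hEadm.proj_mem ha _) (proj_mem 𝒜 _ _))
        (h.mem_of_lt (by omega) (hEadm.proj_mem hb _) (proj_mem 𝒜 _ _))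
    rw [map_add, map_add, LinearMap.mem_ker.1 (hg hrest), hε, hε, smul_one_mul, mul_smul_one,
      map_smul, map_smul, hf, hf, smul_eq_mul, smul_eq_mul]
    ring
  refine ⟨contract f ∘ₗ Δ.toLinearMap, fun c hc => ?_, ?_, fun a ha b hb => ?_⟩
  · have : tensorSub (Subalgebra.toSubmodule C) (Subalgebra.toSubmodule C) ≤
        LinearMap.ker (contract f) := tensorSub_le fun a _ b hb => by
      rw [LinearMap.mem_ker, contract_tmul, hfC b hb, zero_smul]
    exact this (mem_tensorSq.1 (h.admissible.map_mem hc))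
  · have : tensorSub (Subalgebra.toSubmodule C ⊓ posPart 𝒜) (Subalgebra.toSubmodule C ⊓ posPart 𝒜) ≤
        LinearMap.ker (contract f) := tensorSub_le fun a _ b hb => by
      rw [LinearMap.mem_ker, contract_tmul, hfC b hb.1, zero_smul]
    have h2 := LinearMap.mem_ker.1 (this (h.primitive_mod hΔ))
    rw [map_sub, map_add, contract_tmul, contract_tmul, hfz, hfC 1 (one_mem C), one_smul,
      zero_smul, add_zero, sub_eq_zero] at h2
    exact h2
  -- The Leibniz rule for f passes to contractions on E ⊗ E. Since contracting Δ(a) with ε returns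
  -- a, it becomes the Leibniz rule for D.
  · have key : ∀ s ∈ tensorSq E, ∀ t ∈ tensorSq E,
        contract f (s * t) = contract f s * contract ε t + contract ε s * contract f t := by
      intro s hs t ht
      refine tensorSq_induction (LinearMap.eqLocus (contract f ∘ₗ LinearMap.mulRight k t)
        (LinearMap.mulRight k (contract ε t) ∘ₗ contract f +
          LinearMap.mulRight k (contract f t) ∘ₗ contract ε)) (fun a ha b hb => ?_) hs
      refine tensorSq_induction (LinearMap.eqLocus (contract f ∘ₗ LinearMap.mulLeft k (a ⊗ₜ[k] b))
        (LinearMap.mulLeft k (contract f (a ⊗ₜ[k] b)) ∘ₗ contract ε +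
          LinearMap.mulLeft k (contract ε (a ⊗ₜ[k] b)) ∘ₗ contract f)) (fun a' ha' b' hb' => ?_) ht
      simp only [LinearMap.mem_eqLocus, LinearMap.comp_apply, LinearMap.mulLeft_apply,
        LinearMap.add_apply, Algebra.TensorProduct.tmul_mul_tmul, contract_tmul,
        hfmul b hb b' hb', smul_mul_smul_comm, add_smul]
    change contract f (Δ (a * b)) = contract f (Δ a) * b + a * contract f (Δ b)
    rw [map_mul, key _ (hEadm.map_mem ha) _ (hEadm.map_mem hb), contract_counit_comul hΔ hε,
      contract_counit_comul hΔ hε]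

/-- The space `C + C z + ⋯ + C zⁿ⁻¹`. -/
def powSpan (C : Subalgebra k A) (z : A) : ℕ → Submodule k A
  | 0 => ⊥
  | n + 1 => powSpan C z n ⊔ (Subalgebra.toSubmodule C).map (LinearMap.mulRight k (z ^ n))

theorem powSpan_le_succ (C : Subalgebra k A) (z : A) (n : ℕ) :
    powSpan C z n ≤ powSpan C z (n + 1) := le_sup_left

theorem mul_pow_mem_powSpan {C : Subalgebra k A} (z : A) {c : A} (hc : c ∈ C) (n : ℕ) :
    c * z ^ n ∈ powSpan C z (n + 1) :=
  Submodule.mem_sup_right ⟨c, hc, rfl⟩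

theorem mem_powSpan_succ {C : Subalgebra k A} {z : A} {n : ℕ} {a : A}
    (ha : a ∈ powSpan C z (n + 1)) : ∃ b ∈ powSpan C z n, ∃ c ∈ C, a = b + c * z ^ n := by
  obtain ⟨b, hb, _, ⟨c, hc, rfl⟩, rfl⟩ := Submodule.mem_sup.1 ha
  exact ⟨b, hb, c, hc, rfl⟩

theorem mul_mem_powSpan {C : Subalgebra k A} {z c : A} (hc : c ∈ C) (n : ℕ) :
    ∀ a ∈ powSpan C z n, c * a ∈ powSpan C z n := by
  induction n with
  | zero => rintro a ha; rw [(Submodule.mem_bot k).1 ha, mul_zero]; exact zero_mem _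
  | succ n ih =>
    intro a ha
    obtain ⟨b, hb, c', hc', rfl⟩ := mem_powSpan_succ ha
    rw [mul_add, ← mul_assoc]
    exact add_mem (powSpan_le_succ C z n (ih b hb)) (mul_pow_mem_powSpan z (mul_mem hc hc') n)

theorem self_mul_mem_powSpan {C : Subalgebra k A} {z : A}
    (hz : ∀ c ∈ C, z * c - c * z ∈ C) (n : ℕ) :
    ∀ a ∈ powSpan C z n, z * a ∈ powSpan C z (n + 1) := by
  induction n with
  | zero => rintro a ha; rw [(Submodule.mem_bot k).1 ha, mul_zero]; exact zero_mem _
  | succ n ih =>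
    intro a ha
    obtain ⟨b, hb, c, hc, rfl⟩ := mem_powSpan_succ ha
    have : z * (b + c * z ^ n) = z * b + (z * c - c * z) * z ^ n + c * z ^ (n + 1) := by
      rw [pow_succ']; noncomm_ring
    rw [this]
    exact add_mem (powSpan_le_succ C z _ (add_mem (ih b hb) (mul_pow_mem_powSpan z (hz c hc) n)))
      (mul_pow_mem_powSpan z hc _)

theorem exists_mem_powSpan {C : Subalgebra k A} {z : A} (hz : ∀ c ∈ C, z * c - c * z ∈ C) {a : A}
    (ha : a ∈ C ⊔ Algebra.adjoin k {z}) : ∃ n, a ∈ powSpan C z n := by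
  have mono : Monotone (powSpan C z) := monotone_nat_of_le_succ (powSpan_le_succ C z)
  -- The left multipliers of the union of the filtration form a subalgebra containing C and z.
  -- Applying a multiplier to 1 gives the claim.
  let T : Subalgebra k A :=
    { carrier := {a | ∀ n, ∀ b ∈ powSpan C z n, ∃ m, a * b ∈ powSpan C z m}
      mul_mem' := fun {x y} hx hy n b hb => by
        obtain ⟨m, hm⟩ := hy n b hb
        obtain ⟨l, hl⟩ := hx m _ hm
        exact ⟨l, by rwa [mul_assoc]⟩
      add_mem' := fun {x y} hx hy n b hb => by
        obtain ⟨m, hm⟩ := hx n b hb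
        obtain ⟨l, hl⟩ := hy n b hb
        exact ⟨max m l, by
          rw [add_mul]; exact add_mem (mono (le_max_left _ _) hm) (mono (le_max_right _ _) hl)⟩
      algebraMap_mem' := fun r n b hb => ⟨n, mul_mem_powSpan (C.algebraMap_mem r) n b hb⟩ }
  have hT : C ⊔ Algebra.adjoin k {z} ≤ T := by
    refine sup_le (fun c hc n b hb => ⟨n, mul_mem_powSpan hc n b hb⟩) (Algebra.adjoin_le ?_)
    rintro _ rfl n b hb
    exact ⟨n + 1, self_mul_mem_powSpan hz n b hb⟩
  obtain ⟨m, hm⟩ := hT ha 1 1 (by simpa using mul_pow_mem_powSpan z (one_mem C) 0)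
  exact ⟨m, by simpa using hm⟩

theorem pow_mul_sub_mem_powSpan {C : Subalgebra k A} {z : A} (hz : ∀ c ∈ C, z * c - c * z ∈ C)
    {c : A} (hc : c ∈ C) (n : ℕ) : z ^ n * c - c * z ^ n ∈ powSpan C z n := by
  induction n with
  | zero => simp
  | succ n ih =>
    have : z ^ (n + 1) * c - c * z ^ (n + 1) =
        z * (z ^ n * c - c * z ^ n) + (z * c - c * z) * z ^ n := by
      rw [pow_succ']; noncomm_ring
    rw [this]
    exact add_mem (self_mul_mem_powSpan hz n _ ih) (mul_pow_mem_powSpan z (hz c hc) n)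

theorem pow_mem_deg {z : A} {d : ℕ} (hz : z ∈ 𝒜 d) (n : ℕ) : z ^ n ∈ 𝒜 (n * d) := by
  simpa using SetLike.pow_mem_graded n hz

theorem list_prod_mem_deg {Γ : Type*} {z : Γ → A} {d : Γ → ℕ} 
    (hz : ∀ γ, z γ ∈ 𝒜 (d γ)) (l : List Γ) :
    (l.map z).prod ∈ 𝒜 (l.map d).sum := by
  induction l with
  | nil => exact one_mem_zero 𝒜
  | cons γ l ih => simpa using SetLike.mul_mem_graded (hz γ) ih

theorem proj_mul_pow {C : Subalgebra k A} (hC : Admissible 𝒜 Δ C) {z : A} {d : ℕ} (hz : z ∈ 𝒜 d)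
    {c : A} (hc : c ∈ C) (m n : ℕ) : ∃ c' ∈ C, proj 𝒜 m (c * z ^ n) = c' * z ^ n ∧
      (c' = 0 ∨ ∃ i, i + n * d = m ∧ c' ∈ 𝒜 i) := by
  by_cases h : n * d ≤ m
  · obtain ⟨i, rfl⟩ := Nat.exists_eq_add_of_le' h
    exact ⟨proj 𝒜 i c, hC.proj_mem hc i, proj_mul_of_mem_right 𝒜 (pow_mem_deg hz n) i c,
      Or.inr ⟨i, rfl, proj_mem 𝒜 i c⟩⟩
  · refine ⟨0, zero_mem C, ?_, Or.inl rfl⟩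
    rw [GradedAlgebra.proj_apply,
      DirectSum.coe_decompose_mul_of_right_mem_of_not_le 𝒜 (pow_mem_deg hz n) h, zero_mul]

theorem proj_mem_powSpan {C : Subalgebra k A} (hC : Admissible 𝒜 Δ C) {z : A} {d : ℕ}
    (hz : z ∈ 𝒜 d) (m n : ℕ) : ∀ a ∈ powSpan C z n, proj 𝒜 m a ∈ powSpan C z n := by
  induction n with
  | zero => rintro a ha; rw [(Submodule.mem_bot k).1 ha, map_zero]; exact zero_mem _
  | succ n ih =>
    intro a ha
    obtain ⟨b, hb, c, hc, rfl⟩ := mem_powSpan_succ ha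
    obtain ⟨c', hc', h, -⟩ := proj_mul_pow hC hz hc m n
    rw [map_add, h]
    exact add_mem (powSpan_le_succ C z n (ih b hb)) (mul_pow_mem_powSpan z hc' n)

end Step

/-! ### The totally ordered family of all steps -/

section Chain

variable {k : Type u} [Field k] {A : Type v} [Ring A] [Algebra k A]
variable (𝒜 : ℕ → Submodule k A) [GradedAlgebra 𝒜] (Δ : A →ₐ[k] A ⊗[k] A)

/-- A totally ordered family of steps leading from `L` to `U`. -/
structure IsStepChain (L U : Subalgebra k A) {Γ : Type*} [LinearOrder Γ] (C : Γ → Subalgebra k A)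
    (z : Γ → A) (d : Γ → ℕ) : Prop where
  step : ∀ γ, IsStep 𝒜 Δ (C γ) (z γ) (d γ)
  le : ∀ γ, L ≤ C γ
  adjoin_le : ∀ γ, C γ ⊔ Algebra.adjoin k {z γ} ≤ U
  adjoin_le_of_lt : ∀ γ δ, γ < δ → C γ ⊔ Algebra.adjoin k {z γ} ≤ C δ
  exhaust : ∀ m, ∀ a ∈ 𝒜 m, a ∈ U → a ∉ L → ∃ γ, a ∈ C γ ⊔ Algebra.adjoin k {z γ} ∧ a ∉ C γ
  exists_min : ∀ m, ∀ S : Set Γ, S.Nonempty → (∀ γ ∈ S, d γ ≤ m) → ∃ γ ∈ S, ∀ δ ∈ S, γ ≤ δ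

variable {𝒜 Δ}

theorem exists_rank (A : Type v) [Zero A] :
    ∃ (o : Type v) (_ : LinearOrder o) (_ : WellFoundedLT o) (ρ : A → o),
      Function.Injective ρ ∧ ∀ x, ρ x ≤ ρ 0 := by
  classical
  let _ : LinearOrder A := WellOrderingRel.isWellOrder.linearOrder
  have _ : WellFoundedLT A := ⟨WellOrderingRel.isWellOrder.wf⟩
  refine ⟨WithTop A, inferInstance, inferInstance, fun x => if x = 0 then ⊤ else (x : WithTop A),
    fun x y h => ?_, fun x => by simp⟩
  by_cases hx : x = 0 <;> by_cases hy : y = 0 <;> simp_all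

theorem exists_stepChain (hΔ : IsPseudoComul 𝒜 Δ)
    (connected : ∀ a, ∃ c : k, proj 𝒜 0 a = c • (1 : A)) {L U : Subalgebra k A} (hLU : L ≤ U)
    (hL : Admissible 𝒜 Δ L) (hU : Admissible 𝒜 Δ U) :
    ∃ (Γ : Type v) (_ : LinearOrder Γ) (C : Γ → Subalgebra k A) (z : Γ → A) (d : Γ → ℕ),
      IsStepChain 𝒜 Δ L U C z d := by
  classical
  obtain ⟨o, _, _, ρ, hρ, h0⟩ := exists_rank A
  -- The refinement can start in degree 1, because degree 0 consists of scalars.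
  have h : IsInterval 𝒜 Δ 1 L U := by
    refine ⟨le_rfl, hLU, hL, hU, fun i hi a _ hai => ?_⟩
    obtain rfl : i = 0 := by omega
    obtain ⟨c, hc⟩ := connected a
    rw [proj_of_mem 𝒜 hai] at hc
    rw [hc]; exact L.smul_mem (one_mem L) c
  let Γ : Type v := {p : Subalgebra k A × A × ℕ // Leaf 𝒜 Δ ρ 1 L U p.1 p.2.1 p.2.2}
  have spec : ∀ γ : Γ, _ := fun γ => γ.2.spec hΔ connected h
  have sep : ∀ γ δ : Γ, _ := fun γ δ => γ.2.separated hΔ connected hρ h δ.2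
  have hlt : ∀ γ : Γ, ¬ (γ.1.1 ⊔ Algebra.adjoin k {γ.1.2.1} ≤ γ.1.1) := fun γ hle =>
    (spec γ).1.notMem (hle (mem_sup_adjoin _ _))
  -- A step is determined by its lower algebra, so inclusion of lower algebras orders the steps;
  -- totality is `Leaf.separated`.
  have hinj : Function.Injective (fun γ : Γ => γ.1.1) := by
    intro γ δ hγδ
    have hγδ' : γ.1.1 = δ.1.1 := hγδ
    rcases sep γ δ with ⟨h1, h2, h3⟩ | h1 | h1
    · exact Subtype.ext (Prod.ext h1 (Prod.ext h2 h3))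
    · exact absurd (hγδ' ▸ h1) (hlt γ)
    · exact absurd (hγδ' ▸ h1) (hlt δ)
  let _ : LinearOrder Γ :=
    { PartialOrder.lift (fun γ : Γ => γ.1.1) hinj with
      le_total := fun γ δ => by
        rcases sep γ δ with ⟨h1, -⟩ | h1 | h1
        · exact Or.inl h1.le
        · exact Or.inl (le_sup_left.trans h1)
        · exact Or.inr (le_sup_left.trans h1)
      toDecidableLE := Classical.decRel _ }
  refine ⟨Γ, inferInstance, fun γ => γ.1.1, fun γ => γ.1.2.1, fun γ => γ.1.2.2,
    fun γ => (spec γ).1, fun γ => (spec γ).2.1, fun γ => (spec γ).2.2.1, fun γ δ hγδ => ?_,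
    fun m a ha haU haL => ?_, fun m S hS hSm => ?_⟩
  · have hγδ' : γ.1.1 < δ.1.1 := hγδ
    rcases sep γ δ with ⟨h1, -⟩ | h1 | h1
    · exact absurd h1 hγδ'.ne
    · exact h1
    · exact absurd (le_sup_left.trans h1) hγδ'.not_ge
  · obtain ⟨C, z, d, hl, h1, h2⟩ := exists_leaf hΔ connected hρ h0 ha m h (by omega) haU haL
    exact ⟨⟨(C, z, d), hl⟩, h1, h2⟩
  · obtain ⟨_, ⟨γ, hγ, rfl⟩, hmin⟩ := Leaf.exists_min (ρ := ρ) hΔ connected hρ m m h (by omega)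
      ((fun γ : Γ => γ.1.1) '' S) (hS.image _) (by
        rintro _ ⟨γ, hγ, rfl⟩; exact ⟨_, _, hSm γ hγ, γ.2⟩)
    exact ⟨γ, hγ, fun δ hδ => hmin _ ⟨δ, hδ, rfl⟩⟩

end Chain

/-! ### Ordered monomials: independence and spanning -/

section Basis

variable {k : Type u} [Field k] {A : Type v} [Ring A] [Algebra k A]
variable {𝒜 : ℕ → Submodule k A} [GradedAlgebra 𝒜] {Δ : A →ₐ[k] A ⊗[k] A}
variable {L U : Subalgebra k A} {Γ : Type*} [LinearOrder Γ] {C : Γ → Subalgebra k A}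
  {z : Γ → A} {d : Γ → ℕ}

theorem IsStepChain.mono (h : IsStepChain 𝒜 Δ L U C z d) : Monotone C := fun γ δ hγδ => by
  rcases hγδ.eq_or_lt with rfl | hlt
  · exact le_rfl
  · exact le_sup_left.trans (h.adjoin_le_of_lt γ δ hlt)

theorem IsStepChain.mem_of_lt (h : IsStepChain 𝒜 Δ L U C z d) {γ δ : Γ} (hγδ : γ < δ) :
    z γ ∈ C δ := h.adjoin_le_of_lt γ δ hγδ (mem_sup_adjoin _ _)

theorem IsStepChain.prod_mem_of_lt (h : IsStepChain 𝒜 Δ L U C z d) {γ : Γ} {l : List Γ}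
    (hl : ∀ δ ∈ l, δ < γ) : (l.map z).prod ∈ C γ :=
  list_prod_mem fun x hx => by
    obtain ⟨δ, hδ, rfl⟩ := List.mem_map.1 hx
    exact h.mem_of_lt (hl δ hδ)

theorem IsStepChain.prod_mem_of_le (h : IsStepChain 𝒜 Δ L U C z d) {γ : Γ} {l : List Γ}
    (hl : ∀ δ ∈ l, δ ≤ γ) : (l.map z).prod ∈ C γ ⊔ Algebra.adjoin k {z γ} :=
  list_prod_mem fun x hx => by
    obtain ⟨δ, hδ, rfl⟩ := List.mem_map.1 hx
    rcases (hl δ hδ).eq_or_lt with rfl | hlt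
    · exact mem_sup_adjoin _ _
    · exact (le_sup_left : C γ ≤ _) (h.mem_of_lt hlt)

/-- The usual rule for differentiating m z^n, where D kills the product m of the smaller generators;
the integer is the multiplicity of γ. -/
theorem IsStepChain.deriv_prod (h : IsStepChain 𝒜 Δ L U C z d) {γ : Γ} {D : A →ₗ[k] A}
    (hDC : ∀ c ∈ C γ, D c = 0) (hDz : D (z γ) = 1)
    (hD : ∀ a ∈ C γ ⊔ Algebra.adjoin k {z γ}, ∀ b ∈ C γ ⊔ Algebra.adjoin k {z γ},
      D (a * b) = D a * b + a * D b) (l : List Γ) (hl : (l ++ [γ]).Pairwise (· ≤ ·)) :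
    ∃ n : ℕ, 1 ≤ n ∧ D ((l ++ [γ]).map z).prod = n • (l.map z).prod := by
  induction l using List.reverseRecOn with
  | nil => exact ⟨1, le_rfl, by simpa using hDz⟩
  | append_singleton l δ ih =>
    have hle : ∀ x ∈ l ++ [δ], x ≤ γ := fun x hx =>
      (List.pairwise_append.1 hl).2.2 x hx γ (by simp)
    have hl' : (l ++ [δ]).Pairwise (· ≤ ·) := (List.pairwise_append.1 hl).1
    have hprod : D ((l ++ [δ] ++ [γ]).map z).prod =
        D ((l ++ [δ]).map z).prod * z γ + ((l ++ [δ]).map z).prod := by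
      rw [List.map_append, List.prod_append, List.map_singleton, List.prod_singleton,
        hD _ (h.prod_mem_of_le hle) _ (mem_sup_adjoin _ _), hDz, mul_one]
    rcases (hle δ (by simp)).eq_or_lt with rfl | hlt
    · obtain ⟨n, hn, hDn⟩ := ih hl'
      refine ⟨n + 1, by omega, ?_⟩
      rw [hprod, hDn, List.map_append, List.prod_append, List.map_singleton, List.prod_singleton,
        smul_mul_assoc, add_smul, one_smul]
    · refine ⟨1, le_rfl, ?_⟩
      rw [hprod, hDC _ (h.prod_mem_of_lt fun x hx => ?_), zero_mul, zero_add, one_smul]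
      rcases List.mem_append.1 hx with hx | hx
      · exact ((List.pairwise_append.1 hl').2.2 x hx δ (by simp)).trans_lt hlt
      · rw [List.mem_singleton.1 hx]; exact hlt

/-- A nondecreasing sequence without its last term. -/
def dropLast (l : NondecSeq Γ) : NondecSeq Γ :=
  ⟨l.1.dropLast, l.2.sublist (List.dropLast_sublist _)⟩

theorem eq_dropLast_append {l : NondecSeq Γ} {γ : Γ} (hl : ∀ δ ∈ l.1, δ ≤ γ) (hγ : γ ∈ l.1) :
    l.1 = (dropLast l).1 ++ [γ] := by
  have hne : l.1 ≠ [] := List.ne_nil_of_mem hγ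
  have h1 := List.dropLast_append_getLast hne
  have h2 : l.1.getLast hne = γ := by
    refine le_antisymm (hl _ (List.getLast_mem hne)) ?_
    have hp := l.2
    rw [← h1] at hγ hp
    rcases List.mem_append.1 hγ with h | h
    · exact (List.pairwise_append.1 hp).2.2 γ h _ (by simp)
    · exact (List.mem_singleton.1 h).le
  rw [h2] at h1
  exact h1.symm

/-- Ordered monomials are independent, with coefficients on either side. -/
theorem IsStepChain.coeff_eq_zero [CharZero k] [Nontrivial A] (h : IsStepChain 𝒜 Δ L U C z d)
    (hΔ : IsPseudoComul 𝒜 Δ) {ε : A →ₗ[k] k} (hε : ∀ a, proj 𝒜 0 a = ε a • (1 : A))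
    {T : A →ₗ[k] A →ₗ[k] A} (hT : T = LinearMap.mul k A ∨ T = (LinearMap.mul k A).flip) (N : ℕ) :
    ∀ (s : Finset (NondecSeq Γ)) (g : NondecSeq Γ → A), ∑ l ∈ s, l.1.length ≤ N →
      (∀ l, g l ∈ L) → ∑ l ∈ s, T (g l) (monomial z l) = 0 → ∀ l ∈ s, g l = 0 := by
  classical
  have hT1 : ∀ b, T b 1 = b := by rcases hT with rfl | rfl <;> simp
  have hT2 : ∀ (γ : Γ) {b a : A}, b ∈ L → a ∈ C γ → T b a ∈ C γ := by
    rcases hT with rfl | rfl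
    · exact fun γ b a hb ha => mul_mem (h.le γ hb) ha
    · exact fun γ b a hb ha => mul_mem ha (h.le γ hb)
  induction N with
  | zero =>
    intro s g hs hg hsum l hl
    have hlen : ∀ l ∈ s, l.1.length = 0 := by simpa using hs
    have hnil : ∀ l ∈ s, l = ⟨[], List.Pairwise.nil⟩ := fun l hl =>
      Subtype.ext (List.length_eq_zero_iff.1 (hlen l hl))
    obtain rfl : s = {l} := by
      ext l'
      rw [Finset.mem_singleton]
      exact ⟨fun h' => (hnil l' h').trans (hnil l hl).symm, fun h' => h' ▸ hl⟩
    rw [Finset.sum_singleton, hnil l hl] at hsum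
    rw [hnil l hl]
    simpa [monomial, hT1] using hsum
  | succ N ih =>
    intro s g hs hg hsum
    by_cases hG : (s.biUnion fun l => l.1.toFinset).Nonempty
    swap
    · refine ih s g ?_ hg hsum
      rw [Finset.sum_eq_zero]
      · omega
      intro l hl
      rw [List.length_eq_zero_iff, List.eq_nil_iff_forall_not_mem]
      exact fun γ hγ => hG ⟨γ, Finset.mem_biUnion.2 ⟨l, hl, List.mem_toFinset.2 hγ⟩⟩
    -- Differentiate with respect to the largest generator that occurs. Terms without it vanish, the
    -- others lose one factor, and the total length drops.
    obtain ⟨γ, hγG, hγmax⟩ := Finset.exists_max_image _ id hG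
    obtain ⟨l₀, hl₀, hγl₀⟩ := Finset.mem_biUnion.1 hγG
    rw [List.mem_toFinset] at hγl₀
    have hmax : ∀ l ∈ s, ∀ δ ∈ l.1, δ ≤ γ := fun l hl δ hδ =>
      hγmax δ (Finset.mem_biUnion.2 ⟨l, hl, List.mem_toFinset.2 hδ⟩)
    obtain ⟨D, hDC, hDz, hD⟩ := (h.step γ).exists_deriv hΔ hε
    set s₁ := s.filter fun l => γ ∈ l.1 with hs₁
    set s₂ := s.filter fun l => ¬ γ ∈ l.1 with hs₂
    have hsplit : ∀ f : NondecSeq Γ → A, ∑ l ∈ s, f l = ∑ l ∈ s₁, f l + ∑ l ∈ s₂, f l := fun f =>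
      (Finset.sum_filter_add_sum_filter_not s _ f).symm
    have hlast : ∀ l ∈ s₁, l.1 = (dropLast l).1 ++ [γ] := fun l hl =>
      eq_dropLast_append (hmax l (Finset.mem_filter.1 hl).1) (Finset.mem_filter.1 hl).2
    have hlen : ∑ l ∈ s₁, l.1.length + ∑ l ∈ s₂, l.1.length ≤ N + 1 := by
      rw [Finset.sum_filter_add_sum_filter_not]; exact hs
    have hl₀s₁ : l₀ ∈ s₁ := Finset.mem_filter.2 ⟨hl₀, hγl₀⟩
    have hlen₁ : ∑ l ∈ s₁, (dropLast l).1.length + 1 ≤ ∑ l ∈ s₁, l.1.length := by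
      refine Nat.succ_le_of_lt (Finset.sum_lt_sum (fun l hl => ?_) ⟨l₀, hl₀s₁, ?_⟩)
      · conv_rhs => rw [hlast l hl]
        simp
      · conv_rhs => rw [hlast l₀ hl₀s₁]
        simp
    have hderiv : ∀ l, ∃ n : ℕ, 1 ≤ n ∧ (l ∈ s₁ →
        D (T (g l) (monomial z l)) = T ((n : k) • g l) (monomial z (dropLast l))) := by
      intro l
      by_cases hl : l ∈ s₁
      swap
      · exact ⟨1, le_rfl, fun h => absurd h hl⟩
      have hp := l.2
      rw [hlast l hl] at hp
      obtain ⟨n, hn, hDn⟩ := h.deriv_prod hDC hDz hD (dropLast l).1 hp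
      rw [← hlast l hl] at hDn
      refine ⟨n, hn, fun _ => ?_⟩
      have hgE : g l ∈ C γ ⊔ Algebra.adjoin k {z γ} := (le_sup_left : C γ ≤ _) (h.le γ (hg l))
      have hmE : monomial z l ∈ C γ ⊔ Algebra.adjoin k {z γ} :=
        h.prod_mem_of_le (hmax l (Finset.mem_filter.1 hl).1)
      have : D (T (g l) (monomial z l)) = T (g l) (D (monomial z l)) := by
        rcases hT with rfl | rfl
        · simp only [LinearMap.mul_apply']
          rw [hD _ hgE _ hmE, hDC _ (h.le γ (hg l)), zero_mul, zero_add]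
        · simp only [LinearMap.mul_apply', LinearMap.flip_apply]
          rw [hD _ hmE _ hgE, hDC _ (h.le γ (hg l)), mul_zero, add_zero]
      rw [this, map_smul, LinearMap.smul_apply, Nat.cast_smul_eq_nsmul]
      exact (congrArg (T (g l)) hDn).trans (map_nsmul _ _ _)
    choose n hn hDn using hderiv
    have hinj : Set.InjOn (dropLast (Γ := Γ)) s₁ := fun l hl l' hl' e =>
      Subtype.ext ((hlast l hl).trans
        ((congrArg (fun x => x.1 ++ [γ]) e).trans (hlast l' hl').symm))
    have hne : Nonempty (NondecSeq Γ) := ⟨l₀⟩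
    -- The induction hypothesis needs coefficients indexed by the shortened sequences. Shortening is
    -- injective on s₁, where every sequence ends in γ.
    let inv := Function.invFunOn (dropLast (Γ := Γ)) s₁
    have hinv : ∀ l ∈ s₁, inv (dropLast l) = l := fun l hl => hinj.leftInvOn_invFunOn hl
    have hD0 : ∑ l ∈ s₁, T ((n l : k) • g l) (monomial z (dropLast l)) = 0 := by
      have h0 := congrArg D hsum
      rw [map_zero, map_sum, hsplit, Finset.sum_eq_zero (s := s₂), add_zero] at h0
      · rw [← h0]
        exact Finset.sum_congr rfl fun l hl => (hDn l hl).symm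
      · intro l hl
        obtain ⟨hls, hlγ⟩ := Finset.mem_filter.1 hl
        exact hDC _ (hT2 γ (hg l) (h.prod_mem_of_lt fun δ hδ =>
          lt_of_le_of_ne (hmax l hls δ hδ) fun e => hlγ (e ▸ hδ)))
    have hz₁ : ∀ l ∈ s₁, g l = 0 := by
      intro l hl
      have := ih (s₁.image dropLast) (fun l' => (n (inv l') : k) • g (inv l')) (by
          rw [Finset.sum_image hinj]; omega) (fun l' => L.smul_mem (hg _) _) (by
          rw [Finset.sum_image hinj, ← hD0]
          refine Finset.sum_congr rfl fun l hl => ?_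
          simp only [hinv l hl]) (dropLast l) (Finset.mem_image_of_mem _ hl)
      simp only [hinv l hl] at this
      refine (smul_eq_zero.1 this).resolve_left ?_
      have := hn l
      exact Nat.cast_ne_zero.2 (by omega)
    have hz₂ : ∀ l ∈ s₂, g l = 0 := by
      refine ih s₂ g (by omega) hg ?_
      rw [hsplit, Finset.sum_eq_zero (s := s₁), zero_add] at hsum
      · exact hsum
      · intro l hl
        rw [hz₁ l hl, map_zero, LinearMap.zero_apply]
    intro l hl
    by_cases hγl : γ ∈ l.1
    · exact hz₁ l (Finset.mem_filter.2 ⟨hl, hγl⟩)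
    · exact hz₂ l (Finset.mem_filter.2 ⟨hl, hγl⟩)

/-- Sums of ordered monomials in the `z γ`, `γ ∈ S`, with coefficients in `L`. -/
def monomialSums (L : Subalgebra k A) (z : Γ → A) (T : A →ₗ[k] A →ₗ[k] A) (S : Set Γ) :
    AddSubmonoid A :=
  AddSubmonoid.closure {x | ∃ b ∈ L, ∃ l : NondecSeq Γ, (∀ δ ∈ l.1, δ ∈ S) ∧ x = T b (monomial z l)}

theorem monomialSums_mono (T : A →ₗ[k] A →ₗ[k] A) {S S' : Set Γ} (hS : S ⊆ S') :
    monomialSums L z T S ≤ monomialSums L z T S' :=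
  AddSubmonoid.closure_mono fun _ ⟨b, hb, l, hl, e⟩ => ⟨b, hb, l, fun δ hδ => hS (hl δ hδ), e⟩

theorem mem_monomialSums_of_mem {T : A →ₗ[k] A →ₗ[k] A}
    (hT : T = LinearMap.mul k A ∨ T = (LinearMap.mul k A).flip) (S : Set Γ) {b : A} (hb : b ∈ L) :
    b ∈ monomialSums L z T S := by
  refine AddSubmonoid.subset_closure ⟨b, hb, ⟨[], List.Pairwise.nil⟩, by simp, ?_⟩
  rcases hT with rfl | rfl <;> simp [monomial]

theorem proj_mem_monomialSums (hz : ∀ γ, z γ ∈ 𝒜 (d γ)) (hL : Admissible 𝒜 Δ L)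
    {T : A →ₗ[k] A →ₗ[k] A} (hT : T = LinearMap.mul k A ∨ T = (LinearMap.mul k A).flip)
    (S : Set Γ) (m : ℕ) {a : A} (ha : a ∈ monomialSums L z T S) :
    proj 𝒜 m a ∈ monomialSums L z T S := by
  induction ha using AddSubmonoid.closure_induction with
  | zero => rw [map_zero]; exact zero_mem _
  | add x y _ _ hx hy => rw [map_add]; exact add_mem hx hy
  | mem x hx =>
    obtain ⟨b, hb, l, hl, rfl⟩ := hx
    have hm : monomial z l ∈ 𝒜 (l.1.map d).sum := list_prod_mem_deg hz l.1
    by_cases hle : (l.1.map d).sum ≤ m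
    · refine AddSubmonoid.subset_closure ⟨_, hL.proj_mem hb (m - (l.1.map d).sum), l, hl, ?_⟩
      obtain ⟨i, rfl⟩ := Nat.exists_eq_add_of_le hle
      rw [Nat.add_sub_cancel_left]
      rcases hT with rfl | rfl
      · rw [add_comm]; exact proj_mul_of_mem_right 𝒜 hm i b
      · exact proj_mul_of_mem_left 𝒜 hm i b
    · have : proj 𝒜 m (T b (monomial z l)) = 0 := by
        rw [GradedAlgebra.proj_apply]
        rcases hT with rfl | rfl
        · exact DirectSum.coe_decompose_mul_of_right_mem_of_not_le 𝒜 hm hle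
        · exact DirectSum.coe_decompose_mul_of_left_mem_of_not_le 𝒜 hm hle
      rw [this]; exact zero_mem _

theorem pairwise_append_replicate {l : List Γ} {γ : Γ} (hl : l.Pairwise (· ≤ ·))
    (hγ : ∀ δ ∈ l, δ ≤ γ) (i : ℕ) : (l ++ List.replicate i γ).Pairwise (· ≤ ·) := by
  refine List.pairwise_append.2 ⟨hl, List.pairwise_replicate.2 (Or.inr le_rfl), fun a ha b hb => ?_⟩
  rw [List.eq_of_mem_replicate hb]; exact hγ a ha

/-- Multiplying by a power of the next generator, up to terms of lower order. -/
theorem IsStepChain.exists_mul_pow_sub_mem (h : IsStepChain 𝒜 Δ L U C z d)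
    {T : A →ₗ[k] A →ₗ[k] A} (hT : T = LinearMap.mul k A ∨ T = (LinearMap.mul k A).flip)
    (γ : Γ) (i : ℕ) {c : A} (hc : c ∈ monomialSums L z T (Set.Iio γ)) :
    ∃ y ∈ monomialSums L z T (Set.Iic γ), c * z γ ^ i - y ∈ powSpan (C γ) (z γ) i := by
  induction hc using AddSubmonoid.closure_induction with
  | zero => exact ⟨0, zero_mem _, by simp⟩
  | add x y _ _ hx hy =>
    obtain ⟨x', hx', hx⟩ := hx
    obtain ⟨y', hy', hy⟩ := hy
    refine ⟨x' + y', add_mem hx' hy', ?_⟩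
    have : (x + y) * z γ ^ i - (x' + y') = (x * z γ ^ i - x') + (y * z γ ^ i - y') := by
      rw [add_mul]; abel
    rw [this]; exact add_mem hx hy
  | mem x hx =>
    obtain ⟨b, hb, l, hl, rfl⟩ := hx
    have hl' : ∀ δ ∈ l.1, δ < γ := hl
    let l₁ : NondecSeq Γ := ⟨l.1 ++ List.replicate i γ,
      pairwise_append_replicate l.2 (fun δ hδ => (hl' δ hδ).le) i⟩
    have hm : monomial z l₁ = monomial z l * z γ ^ i := by simp [monomial, l₁]
    refine ⟨T b (monomial z l₁), AddSubmonoid.subset_closure ⟨b, hb, l₁, fun δ hδ => ?_, rfl⟩, ?_⟩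
    · rcases List.mem_append.1 hδ with hδ | hδ
      · exact (hl' δ hδ).le
      · exact (List.eq_of_mem_replicate hδ).le
    · rw [hm]
      rcases hT with rfl | rfl
      · simp [mul_assoc]
      · simp only [LinearMap.flip_apply, LinearMap.mul_apply']
        have : monomial z l * b * z γ ^ i - monomial z l * z γ ^ i * b =
            (-monomial z l) * (z γ ^ i * b - b * z γ ^ i) := by noncomm_ring
        rw [this]
        exact mul_mem_powSpan (neg_mem (h.prod_mem_of_lt hl')) i _
          (pow_mul_sub_mem_powSpan (h.step γ).comm_mem (h.le γ hb) i)

/-- A homogeneous element of C γ outside L is captured by a step, and that step must precede γ. -/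
theorem IsStepChain.mem_monomialSums_Iio (h : IsStepChain 𝒜 Δ L U C z d)
    {T : A →ₗ[k] A →ₗ[k] A} (hT : T = LinearMap.mul k A ∨ T = (LinearMap.mul k A).flip)
    {γ : Γ} {m : ℕ} (hlow : ∀ δ < γ, ∀ a ∈ 𝒜 m, a ∈ C δ ⊔ Algebra.adjoin k {z δ} → a ∉ C δ →
      a ∈ monomialSums L z T (Set.Iic δ)) {a : A} (ha : a ∈ 𝒜 m) (haC : a ∈ C γ) :
    a ∈ monomialSums L z T (Set.Iio γ) := by
  by_cases haL : a ∈ L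
  · exact mem_monomialSums_of_mem hT _ haL
  obtain ⟨δ, h1, h2⟩ := h.exhaust m a ha (h.adjoin_le γ ((le_sup_left : C γ ≤ _) haC)) haL
  have hδγ : δ < γ := not_le.1 fun hle => h2 (h.mono hle haC)
  exact monomialSums_mono T (fun x (hx : x ≤ δ) => hx.trans_lt hδγ) (hlow δ hδγ a ha h1 h2)

/-- Strong induction on the degree, then a first counterexample among the steps, then induction on
the power of z. Only steps of degree at most m matter, which is why the limited well-ordering in
`IsStepChain` suffices. -/
theorem IsStepChain.mem_monomialSums_Iic (h : IsStepChain 𝒜 Δ L U C z d)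
    (hL : Admissible 𝒜 Δ L)
    {T : A →ₗ[k] A →ₗ[k] A} (hT : T = LinearMap.mul k A ∨ T = (LinearMap.mul k A).flip) (m : ℕ) :
    ∀ γ, ∀ a ∈ 𝒜 m, a ∈ C γ ⊔ Algebra.adjoin k {z γ} → a ∉ C γ →
      a ∈ monomialSums L z T (Set.Iic γ) := by
  have hz : ∀ γ, z γ ∈ 𝒜 (d γ) := fun γ => (h.step γ).mem_deg
  induction m using Nat.strong_induction_on with
  | _ m ih =>
  by_contra! hcon
  let S : Set Γ := {γ | ∃ a ∈ 𝒜 m, a ∈ C γ ⊔ Algebra.adjoin k {z γ} ∧ a ∉ C γ ∧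
    a ∉ monomialSums L z T (Set.Iic γ)}
  obtain ⟨γ, ⟨a, ham, haE, haC, hna⟩, hmin⟩ := h.exists_min m S hcon (by
    rintro γ ⟨a, ham, haE, haC, -⟩
    exact not_lt.1 fun hlt => haC ((h.step γ).mem_of_lt hlt haE ham))
  have hlow : ∀ a ∈ 𝒜 m, a ∈ C γ → a ∈ monomialSums L z T (Set.Iio γ) := fun a ha haC =>
    h.mem_monomialSums_Iio hT (fun δ hδ a ha h1 h2 => by
      by_contra h3
      exact hδ.not_ge (hmin δ ⟨a, ha, h1, h2, h3⟩)) ha haC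
  have hIio : monomialSums L z T (Set.Iio γ) ≤ monomialSums L z T (Set.Iic γ) :=
    monomialSums_mono T Set.Iio_subset_Iic_self
  have hadm := (h.step γ).admissible
  have main : ∀ i, ∀ a ∈ 𝒜 m, a ∈ powSpan (C γ) (z γ) i →
      a ∈ monomialSums L z T (Set.Iic γ) := by
    intro i
    induction i with
    | zero => intro a _ ha; rw [(Submodule.mem_bot k).1 ha]; exact zero_mem _
    | succ i ihi =>
      intro a ha haP
      obtain ⟨b, hb, c, hc, rfl⟩ := mem_powSpan_succ haP
      obtain ⟨c', hc', hcc', hdeg⟩ := proj_mul_pow hadm (hz γ) hc m i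
      rw [← proj_of_mem 𝒜 ha, map_add, hcc']
      refine add_mem (ihi _ (proj_mem 𝒜 m b) (proj_mem_powSpan hadm (hz γ) m i b hb)) ?_
      rcases hdeg with rfl | ⟨j, hj, hc'j⟩
      · rw [zero_mul]; exact zero_mem _
      rcases Nat.eq_zero_or_pos i with rfl | hi
      · rw [zero_mul, add_zero] at hj
        rw [pow_zero, mul_one]
        exact hIio (hlow c' (hj ▸ hc'j) hc')
      -- A coefficient of a positive power of z has smaller degree, so the degree induction applies
      -- to it. For power zero its degree is still m, and minimality of γ was used instead.
      · have hjm : j < m := by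
          have := Nat.mul_pos hi (h.step γ).one_le
          omega
        have hc'M : c' ∈ monomialSums L z T (Set.Iio γ) :=
          h.mem_monomialSums_Iio hT (fun δ _ a ha h1 h2 => ih j hjm δ a ha h1 h2) hc'j hc'
        -- The error, nonzero only for coefficients on the right, has lower powers of z. Projecting
        -- to degree m makes the inner induction applicable.
        obtain ⟨y, hy, hyP⟩ := h.exists_mul_pow_sub_mem hT γ i hc'M
        have : c' * z γ ^ i = proj 𝒜 m y + proj 𝒜 m (c' * z γ ^ i - y) := by
          rw [← map_add, add_sub_cancel, ← hcc', proj_of_mem 𝒜 (proj_mem 𝒜 m _)]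
        rw [this]
        exact add_mem (proj_mem_monomialSums hz hL hT _ m hy)
          (ihi _ (proj_mem 𝒜 m _) (proj_mem_powSpan hadm (hz γ) m i _ hyP))
  obtain ⟨i, hi⟩ := exists_mem_powSpan (h.step γ).comm_mem haE
  exact hna (main i a ham hi)

theorem IsStepChain.le_monomialSums (h : IsStepChain 𝒜 Δ L U C z d)
    (hL : Admissible 𝒜 Δ L) (hU : Admissible 𝒜 Δ U)
    {T : A →ₗ[k] A →ₗ[k] A} (hT : T = LinearMap.mul k A ∨ T = (LinearMap.mul k A).flip)
    {a : A} (ha : a ∈ U) : a ∈ monomialSums L z T Set.univ := by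
  refine mem_of_proj_mem 𝒜 _ fun i => ?_
  by_cases haL : proj 𝒜 i a ∈ L
  · exact mem_monomialSums_of_mem hT _ haL
  obtain ⟨γ, h1, h2⟩ := h.exhaust i _ (proj_mem 𝒜 i a) (hU.proj_mem ha i) haL
  exact monomialSums_mono T (Set.subset_univ _)
    (h.mem_monomialSums_Iic hL hT i γ _ (proj_mem 𝒜 i a) h1 h2)

/-- Spanning, applied to the steps before γ, identifies the abstract lower algebra with A^{<γ}, so
the properties of steps become the claims of the theorem. -/
theorem IsStepChain.below_eq (h : IsStepChain 𝒜 Δ L U C z d) (hL : Admissible 𝒜 Δ L) (γ : Γ) :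
    below L z γ = C γ := by
  apply le_antisymm
  · refine Algebra.adjoin_le (Set.union_subset (h.le γ) ?_)
    rintro _ ⟨δ, hδ, rfl⟩
    exact h.mem_of_lt hδ
  · intro a ha
    have hzb : ∀ δ < γ, z δ ∈ below L z γ := fun δ hδ =>
      Algebra.subset_adjoin (Or.inr ⟨δ, hδ, rfl⟩)
    have hM : ∀ x ∈ monomialSums L z (LinearMap.mul k A) (Set.Iio γ), x ∈ below L z γ := by
      intro x hx
      induction hx using AddSubmonoid.closure_induction with
      | zero => exact zero_mem _
      | add x y _ _ hx hy => exact add_mem hx hy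
      | mem x hx =>
        obtain ⟨b, hb, l, hl, rfl⟩ := hx
        refine mul_mem (Algebra.subset_adjoin (Or.inl hb)) (list_prod_mem fun x hx => ?_)
        obtain ⟨δ, hδ, rfl⟩ := List.mem_map.1 hx
        exact hzb δ (hl δ hδ)
    refine mem_of_proj_mem 𝒜 (below L z γ).toSubsemiring.toAddSubmonoid fun i => hM _ ?_
    exact h.mem_monomialSums_Iio (Or.inl rfl)
      (fun δ _ a ha h1 h2 => h.mem_monomialSums_Iic hL (Or.inl rfl) i δ a ha h1 h2)
      (proj_mem 𝒜 i a) ((h.step γ).admissible.proj_mem ha i)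

end Basis

/-! ### Polynomial growth and the Gelfand-Kirillov dimension -/

section Growth

open Filter Topology

/-- With c = log x this is the limit of log_n((x n)^r), the comparison function in both dimension
bounds. -/
theorem tendsto_ofReal_mul_one_add_div_log (r : ℕ) (c : ℝ) :
    Tendsto (fun n : ℕ => ENNReal.ofReal (r * (1 + c / Real.log n))) atTop (𝓝 (r : ℝ≥0∞)) := by
  have h1 : Tendsto (fun n : ℕ => Real.log n) atTop atTop :=
    Real.tendsto_log_atTop.comp tendsto_natCast_atTop_atTop
  have h2 : Tendsto (fun n : ℕ => (r : ℝ) * (1 + c / Real.log n)) atTop (𝓝 (r * (1 + 0))) :=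
    (tendsto_const_nhds.add (h1.const_div_atTop c)).const_mul _
  have h3 := ENNReal.tendsto_ofReal h2
  simpa using h3

theorem logb_pow_mul_natCast {r n : ℕ} (hn : 2 ≤ n) {x : ℝ} (hx : 0 < x) :
    Real.logb n ((x * n) ^ r) = r * (1 + Real.log x / Real.log n) := by
  have hn' : (0 : ℝ) < n := by positivity
  have hlog : Real.log n ≠ 0 := (Real.log_pos (by exact_mod_cast hn)).ne'
  rw [Real.logb, Real.log_pow, Real.log_mul hx.ne' hn'.ne']
  field_simp
  ring

variable {k : Type u} [Field k] {R : Type*} [Ring R] [Algebra k R]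

theorem fg_sum_pow {V : Submodule k R} (hV : V.FG) (n : ℕ) :
    (∑ i ∈ Finset.range (n + 1), V ^ i).FG :=
  Finset.sum_induction _ (fun W : Submodule k R => W.FG) (fun _ _ h h' => h.sup h') Submodule.fg_bot
    fun i _ => hV.pow i

theorem gkdim_le_of_finrank_le (r : ℕ)
    (h : ∀ V : Submodule k R, V.FG → ∃ M : ℕ, ∀ n : ℕ,
      Module.finrank k ↥(∑ i ∈ Finset.range (n + 1), V ^ i) ≤ (M * n + 1) ^ r) :
    gkdim k R ≤ r := by
  refine iSup_le fun V => iSup_le fun hV => ?_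
  obtain ⟨M, hM⟩ := h V hV
  rw [← (tendsto_ofReal_mul_one_add_div_log r (Real.log ((M : ℝ) + 1))).limsup_eq]
  refine limsup_le_limsup ?_
  filter_upwards [eventually_ge_atTop 2] with n hn
  refine ENNReal.ofReal_le_ofReal ?_
  rw [← logb_pow_mul_natCast hn (by positivity)]
  have hn1 : (1 : ℝ) < n := by exact_mod_cast hn
  have hle : (Module.finrank k ↥(∑ i ∈ Finset.range (n + 1), V ^ i) : ℝ) ≤
      (((M : ℝ) + 1) * n) ^ r := by
    have h1 : (Module.finrank k ↥(∑ i ∈ Finset.range (n + 1), V ^ i) : ℝ) ≤ ((M * n + 1) ^ r : ℕ) :=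
      by exact_mod_cast hM n
    refine h1.trans ?_
    push_cast
    gcongr
    nlinarith
  -- Rank zero occurs for the zero ring; then `Real.logb` takes its default value 0.
  rcases Nat.eq_zero_or_pos (Module.finrank k ↥(∑ i ∈ Finset.range (n + 1), V ^ i)) with h0 | h0
  · rw [h0, Nat.cast_zero, Real.logb_zero, logb_pow_mul_natCast hn (by positivity)]
    have : 0 ≤ Real.log ((M : ℝ) + 1) := Real.log_nonneg (by linarith [Nat.cast_nonneg (α := ℝ) M])
    have : 0 < Real.log n := Real.log_pos hn1
    positivity
  · exact Real.logb_le_logb_of_le hn1 (by exact_mod_cast h0) hle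

theorem card_le_gkdim {ι : Type*} [Fintype ι] {m : (ι → ℕ) → R} (hm : LinearIndependent k m)
    {V : Submodule k R} (hV : V.FG) (hmV : ∀ e, m e ∈ V ^ (∑ i, e i)) :
    (Fintype.card ι : ℝ≥0∞) ≤ gkdim k R := by
  classical
  set r := Fintype.card ι with hr
  rcases Nat.eq_zero_or_pos r with h0 | hr0
  · rw [h0]; simp
  refine le_trans ?_ (le_iSup_of_le V (le_iSup_of_le hV le_rfl))
  have hr' : (0 : ℝ) < r := by exact_mod_cast hr0
  rw [← (tendsto_ofReal_mul_one_add_div_log r (Real.log (r : ℝ)⁻¹)).limsup_eq]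
  refine limsup_le_limsup ?_
  filter_upwards [eventually_ge_atTop 2] with n hn
  refine ENNReal.ofReal_le_ofReal ?_
  rw [← logb_pow_mul_natCast hn (by positivity)]
  have hn1 : (1 : ℝ) < n := by exact_mod_cast hn
  refine Real.logb_le_logb_of_le hn1 (by positivity) ?_
  have hfin : Module.Finite k ↥(∑ i ∈ Finset.range (n + 1), V ^ i) :=
    Module.Finite.iff_fg.2 (fg_sum_pow hV n)
  -- With r exponents each at most n / r, the total is at most n. This gives (n / r + 1)^r ≥ (n /
  -- r)^r independent elements, the last quotient being real.
  have hmem : ∀ e : ι → Fin (n / r + 1), m (fun i => e i) ∈ ∑ i ∈ Finset.range (n + 1), V ^ i := by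
    intro e
    have hsum : ∑ i, (e i : ℕ) ≤ n := by
      calc ∑ i, (e i : ℕ) ≤ ∑ _i : ι, n / r := Finset.sum_le_sum fun i _ => by
            have := (e i).2; omega
        _ = r * (n / r) := by simp [hr]
        _ ≤ n := Nat.mul_div_le n r
    have hle : V ^ (∑ i, (e i : ℕ)) ≤ ∑ i ∈ Finset.range (n + 1), V ^ i := by
      rw [← Finset.add_sum_erase _ _ (Finset.mem_range.2 (Nat.lt_succ_of_le hsum))]
      exact le_sup_left
    exact hle (hmV _)
  have hli : LinearIndependent k (fun e : ι → Fin (n / r + 1) =>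
      (⟨m (fun i => e i), hmem e⟩ : ↥(∑ i ∈ Finset.range (n + 1), V ^ i))) := by
    refine LinearIndependent.of_comp (Submodule.subtype _) ?_
    refine hm.comp (fun (e : ι → Fin (n / r + 1)) i => (e i : ℕ)) fun e e' h => ?_
    funext i
    exact Fin.ext (congrFun h i)
  have hcard := hli.fintype_card_le_finrank
  rw [Fintype.card_fun, Fintype.card_fin, ← hr] at hcard
  have h1 : ((n / r + 1 : ℕ) : ℝ) ^ r ≤ Module.finrank k ↥(∑ i ∈ Finset.range (n + 1), V ^ i) := by
    exact_mod_cast hcard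
  refine le_trans ?_ h1
  have h2 : (n : ℝ) / r ≤ ((n / r + 1 : ℕ) : ℝ) := by
    have := Nat.lt_floor_add_one ((n : ℝ) / r)
    rw [Nat.floor_div_eq_div] at this
    push_cast at this ⊢
    exact this.le
  rw [inv_mul_eq_div]
  gcongr

end Growth

/-! ### Dimension of an algebra with a homogeneous monomial basis -/

section GradedGrowth

variable {k : Type u} [Field k] {A : Type v} [Ring A] [Algebra k A]
variable (𝒜 : ℕ → Submodule k A) [GradedAlgebra 𝒜]

/-- The elements with no components of degree larger than `N`. -/
def degLE (N : ℕ) : Submodule k A := ⨅ i : {i : ℕ // N < i}, LinearMap.ker (proj 𝒜 i)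

variable {𝒜}

theorem mem_degLE {N : ℕ} {a : A} : a ∈ degLE 𝒜 N ↔ ∀ i, N < i → proj 𝒜 i a = 0 := by
  simp [degLE, Submodule.mem_iInf]

theorem degLE_mono {M N : ℕ} (h : M ≤ N) : degLE 𝒜 M ≤ degLE 𝒜 N := fun _ ha =>
  mem_degLE.2 fun i hi => mem_degLE.1 ha i (by omega)

theorem mul_mem_degLE {M N : ℕ} {a b : A} (ha : a ∈ degLE 𝒜 M) (hb : b ∈ degLE 𝒜 N) :
    a * b ∈ degLE 𝒜 (M + N) := by
  refine mem_degLE.2 fun i hi => ?_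
  rw [proj_mul]
  refine Finset.sum_eq_zero fun p hp => ?_
  rw [Finset.HasAntidiagonal.mem_antidiagonal] at hp
  by_cases h : M < p.1
  · rw [mem_degLE.1 ha _ h, zero_mul]
  · rw [mem_degLE.1 hb p.2 (by omega), mul_zero]

theorem one_mem_degLE (N : ℕ) : (1 : A) ∈ degLE 𝒜 N :=
  mem_degLE.2 fun i hi => proj_of_mem_ne 𝒜 (one_mem_zero 𝒜) (by omega)

theorem exists_mem_degLE (a : A) : ∃ N, a ∈ degLE 𝒜 N := by
  obtain ⟨s, hs⟩ := exists_sum_proj 𝒜 a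
  refine ⟨s.sup id, mem_degLE.2 fun i hi => ?_⟩
  rw [hs, map_sum]
  refine Finset.sum_eq_zero fun j hj => proj_of_mem_ne 𝒜 (proj_mem 𝒜 j a) ?_
  have : j ≤ s.sup id := Finset.le_sup (f := id) hj
  omega

theorem exists_le_degLE {R : Type*} [Ring R] [Algebra k R] (φ : R →ₐ[k] A) {V : Submodule k R}
    (hV : V.FG) : ∃ N, V ≤ (degLE 𝒜 N).comap φ.toLinearMap := by
  obtain ⟨s, rfl⟩ := hV
  choose N hN using exists_mem_degLE (𝒜 := 𝒜)
  refine ⟨s.sup fun x => N (φ x), Submodule.span_le.2 fun x hx => ?_⟩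
  exact degLE_mono (Finset.le_sup (f := fun x => N (φ x)) hx) (hN (φ x))

theorem sum_pow_le_degLE {R : Type*} [Ring R] [Algebra k R] (φ : R →ₐ[k] A) {V : Submodule k R}
    {N : ℕ} (hV : V ≤ (degLE 𝒜 N).comap φ.toLinearMap) (n : ℕ) :
    ∑ i ∈ Finset.range (n + 1), V ^ i ≤ (degLE 𝒜 (N * n)).comap φ.toLinearMap := by
  have hpow : ∀ i, V ^ i ≤ (degLE 𝒜 (N * i)).comap φ.toLinearMap := by
    intro i
    induction i with
    | zero =>
      rw [pow_zero]
      refine Submodule.one_le.2 ?_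
      change φ 1 ∈ degLE 𝒜 _
      rw [map_one]; exact one_mem_degLE _
    | succ i ih =>
      rw [pow_succ]
      refine Submodule.mul_le.2 fun a ha b hb => ?_
      change φ (a * b) ∈ degLE 𝒜 _
      rw [map_mul, Nat.mul_succ]
      exact mul_mem_degLE (ih ha) (hV hb)
  refine Finset.sum_induction _ (fun W => W ≤ (degLE 𝒜 (N * n)).comap φ.toLinearMap)
    (fun _ _ h h' => sup_le h h') bot_le fun i hi => ?_
  exact (hpow i).trans (Submodule.comap_mono (degLE_mono
    (Nat.mul_le_mul_left N (by have := Finset.mem_range.1 hi; omega))))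

theorem gkdim_le_card {R : Type*} [Ring R] [Algebra k R] (φ : R →ₐ[k] A)
    (hφ : Function.Injective φ) {ι : Type*} [Fintype ι] {m : (ι → ℕ) → R}
    (hm : Submodule.span k (Set.range m) = ⊤) {d : ι → ℕ} (hd : ∀ i, 1 ≤ d i)
    (hdeg : ∀ e, φ (m e) ∈ 𝒜 (∑ i, e i * d i)) : gkdim k R ≤ Fintype.card ι := by
  classical
  refine gkdim_le_of_finrank_le _ fun V hV => ?_
  obtain ⟨N, hN⟩ := exists_le_degLE (𝒜 := 𝒜) φ hV
  refine ⟨N, fun n => ?_⟩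
  let m' : (ι → Fin (N * n + 1)) → R := fun e => m fun i => e i
  have hle : ∑ i ∈ Finset.range (n + 1), V ^ i ≤ Submodule.span k (Set.range m') := by
    intro a ha
    have hadeg := sum_pow_le_degLE φ hN n ha
    have hamem : a ∈ Submodule.span k (Set.range m) := hm ▸ Submodule.mem_top
    obtain ⟨c, rfl⟩ := (Finsupp.mem_span_range_iff_exists_finsupp).1 hamem
    -- Truncation in degrees at most N n fixes the image of a and deletes the monomials of larger
    -- degree. In the others every exponent is at most N n, because the generators have degree at
    -- least 1.
    let P : A →ₗ[k] A := ∑ i ∈ Finset.range (N * n + 1), proj 𝒜 i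
    have hPlow : ∀ j, ∀ a ∈ 𝒜 j, P a = if j ≤ N * n then a else 0 := by
      intro j a ha
      simp only [P, LinearMap.sum_apply]
      split_ifs with hj
      · rw [Finset.sum_eq_single j, proj_of_mem 𝒜 ha]
        · exact fun i _ hij => proj_of_mem_ne 𝒜 ha (Ne.symm hij)
        · exact fun h => absurd (Finset.mem_range.2 (by omega)) h
      · refine Finset.sum_eq_zero fun i hi => proj_of_mem_ne 𝒜 ha ?_
        have := Finset.mem_range.1 hi
        omega
    have hPdeg : ∀ a ∈ degLE 𝒜 (N * n), P a = a := by
      intro a ha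
      obtain ⟨s, hs⟩ := exists_sum_proj 𝒜 a
      conv_lhs => rw [hs, map_sum]
      conv_rhs => rw [hs]
      refine Finset.sum_congr rfl fun i _ => ?_
      rw [hPlow i _ (proj_mem 𝒜 i a)]
      split_ifs with h
      · rfl
      · exact (mem_degLE.1 ha i (by omega)).symm
    have key : (c.sum fun e x => x • m e) =
        c.sum fun e x => if ∑ i, e i * d i ≤ N * n then x • m e else 0 := by
      apply hφ
      have h1 : P (φ (c.sum fun e x => x • m e)) = φ (c.sum fun e x => x • m e) := hPdeg _ hadeg
      rw [← h1, Finsupp.sum, Finsupp.sum, map_sum, map_sum, map_sum]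
      refine Finset.sum_congr rfl fun e _ => ?_
      rw [map_smul, map_smul, hPlow _ _ (hdeg e)]
      split_ifs
      · rw [map_smul]
      · rw [smul_zero, map_zero]
    rw [key]
    refine Submodule.sum_mem _ fun e _ => ?_
    dsimp only
    split_ifs with h
    · refine Submodule.smul_mem _ _ (Submodule.subset_span ⟨fun i => ⟨e i, ?_⟩, rfl⟩)
      have h2 : e i * d i ≤ ∑ i, e i * d i :=
        Finset.single_le_sum (f := fun i => e i * d i) (fun _ _ => Nat.zero_le _)
          (Finset.mem_univ i)
      have h3 : e i * 1 ≤ e i * d i := Nat.mul_le_mul_left _ (hd i)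
      omega
    · exact Submodule.zero_mem _
  have hfin : Module.Finite k ↥(Submodule.span k (Set.range m')) :=
    Module.Finite.iff_fg.2 (Submodule.fg_span (Set.finite_range m'))
  refine (Submodule.finrank_mono hle).trans ((finrank_range_le_card (R := k) m').trans ?_)
  rw [Fintype.card_fun, Fintype.card_fin]

/-- The Gelfand-Kirillov dimension of an algebra with a basis of monomials in homogeneous
generators of positive degree is the number of generators. -/
theorem gkdim_eq_card {R : Type*} [Ring R] [Algebra k R] (φ : R →ₐ[k] A)
    (hφ : Function.Injective φ) {Γ : Type*} {m : (Γ →₀ ℕ) → R} (hli : LinearIndependent k m)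
    (hspan : Submodule.span k (Set.range m) = ⊤) {d : Γ → ℕ} (hd : ∀ γ, 1 ≤ d γ)
    (hdeg : ∀ e, φ (m e) ∈ 𝒜 (e.sum fun γ n => n * d γ)) (z : Γ → R)
    (hmz : ∀ e, ∀ V : Submodule k R, (∀ γ ∈ e.support, z γ ∈ V) → m e ∈ V ^ (e.sum fun _ n => n)) :
    gkdim k R = ((ENat.card Γ : ℕ∞) : ℝ≥0∞) := by
  classical
  have lower : ∀ s : Finset Γ, (s.card : ℝ≥0∞) ≤ gkdim k R := by
    intro s
    let emb : (s → ℕ) → (Γ →₀ ℕ) := fun e =>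
      Finsupp.embDomain (Function.Embedding.subtype _) (Finsupp.equivFunOnFinite.symm e)
    have hemb : Function.Injective emb :=
      (Finsupp.embDomain_injective _).comp Finsupp.equivFunOnFinite.symm.injective
    have hfg : (Submodule.span k (s.image z : Set R)).FG := ⟨s.image z, rfl⟩
    have h := card_le_gkdim (hli.comp emb hemb) hfg (fun e => by
      have h1 := hmz (emb e) (Submodule.span k (s.image z : Set R)) (fun γ hγ => by
        rw [Finsupp.support_embDomain, Finset.mem_map] at hγ
        obtain ⟨x, -, rfl⟩ := hγ
        exact Submodule.subset_span (Finset.mem_coe.2 (Finset.mem_image_of_mem z x.2)))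
      have h2 : ((emb e).sum fun _ n => n) = ∑ i, e i := by
        rw [Finsupp.sum_embDomain, Finsupp.sum_fintype _ _ (fun _ => rfl)]; rfl
      rwa [h2] at h1)
    rwa [Fintype.card_coe] at h
  cases finite_or_infinite Γ with
  | inl hfin =>
    have := Fintype.ofFinite Γ
    rw [ENat.card_eq_coe_fintype_card]
    refine le_antisymm ?_ ?_
    · refine (gkdim_le_card (𝒜 := 𝒜) φ hφ (m := m ∘ Finsupp.equivFunOnFinite.symm) ?_ hd
        fun e => ?_).trans (by simp)
      · rw [Finsupp.equivFunOnFinite.symm.surjective.range_comp, hspan]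
      · have := hdeg (Finsupp.equivFunOnFinite.symm e)
        rwa [Finsupp.sum_fintype _ _ (by simp)] at this
    · simpa using lower Finset.univ
  | inr hinf =>
    rw [ENat.card_eq_top_of_infinite, ENat.toENNReal_top, ← top_le_iff, ← ENNReal.iSup_natCast]
    refine iSup_le fun n => ?_
    obtain ⟨s, rfl⟩ := Infinite.exists_subset_card_eq Γ n
    exact lower s

end GradedGrowth

/-! ### Nondecreasing sequences and exponent vectors -/

section Sequences

variable {Γ : Type*} [LinearOrder Γ]

/-- Nondecreasing sequences correspond to their multiplicities. -/
noncomputable def nondecSeqEquiv : (Γ →₀ ℕ) ≃ NondecSeq Γ where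
  toFun e := ⟨(Finsupp.toMultiset e).sort (· ≤ ·), Multiset.pairwise_sort _ _⟩
  invFun l := Multiset.toFinsupp (l.1 : Multiset Γ)
  left_inv e := by simp [Multiset.sort_eq]
  right_inv l := by
    refine Subtype.ext (List.Perm.eq_of_pairwise (fun a b _ _ => le_antisymm)
      (Multiset.pairwise_sort _ _) l.2 ?_)
    rw [← Multiset.coe_eq_coe, Multiset.sort_eq, Multiset.toFinsupp_toMultiset]

theorem coe_nondecSeqEquiv (e : Γ →₀ ℕ) :
    ((nondecSeqEquiv e).1 : Multiset Γ) = Finsupp.toMultiset e :=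
  Multiset.sort_eq _ _

theorem sum_map_nondecSeqEquiv (e : Γ →₀ ℕ) (d : Γ → ℕ) :
    ((nondecSeqEquiv e).1.map d).sum = e.sum fun γ n => n * d γ := by
  rw [← Multiset.sum_coe, ← Multiset.map_coe, coe_nondecSeqEquiv]
  induction e using Finsupp.induction_linear with
  | zero => simp
  | add f g hf hg =>
    rw [Finsupp.toMultiset_add, Multiset.map_add, Multiset.sum_add, hf, hg,
      Finsupp.sum_add_index' (by simp) (by intros; ring)]
  | single γ n =>
    rw [Finsupp.toMultiset_single, Multiset.map_nsmul, Multiset.sum_nsmul,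
      Finsupp.sum_single_index (by simp)]
    simp

theorem length_nondecSeqEquiv (e : Γ →₀ ℕ) :
    (nondecSeqEquiv e).1.length = e.sum fun _ n => n := by
  simpa using sum_map_nondecSeqEquiv e fun _ => 1

theorem mem_nondecSeqEquiv {e : Γ →₀ ℕ} {γ : Γ} : γ ∈ (nondecSeqEquiv e).1 ↔ γ ∈ e.support := by
  rw [← Multiset.mem_coe, coe_nondecSeqEquiv, Finsupp.mem_toMultiset]

theorem list_prod_mem_pow {k : Type*} [Field k] {R : Type*} [Ring R] [Algebra k R]
    {V : Submodule k R} {l : List R} (h : ∀ x ∈ l, x ∈ V) : l.prod ∈ V ^ l.length := by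
  induction l with
  | nil => simpa using Submodule.one_le.1 (le_refl (1 : Submodule k R))
  | cons a l ih =>
    rw [List.prod_cons, List.length_cons, pow_succ']
    exact Submodule.mul_mem_mul (h a (by simp)) (ih fun x hx => h x (by simp [hx]))

theorem monomial_mem_pow {k : Type*} [Field k] {R : Type*} [Ring R] [Algebra k R]
    {z : Γ → R} (e : Γ →₀ ℕ) {V : Submodule k R} (h : ∀ γ ∈ e.support, z γ ∈ V) :
    monomial z (nondecSeqEquiv e) ∈ V ^ (e.sum fun _ n => n) := by
  have := list_prod_mem_pow (k := k) (V := V) (l := (nondecSeqEquiv e).1.map z) (fun x hx => by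
    obtain ⟨γ, hγ, rfl⟩ := List.mem_map.1 hx
    exact h γ (mem_nondecSeqEquiv.1 hγ))
  rwa [List.length_map, length_nondecSeqEquiv] at this

end Sequences

/-! ### Bases over L and over k, and additivity of the dimension -/

section Main

variable {k : Type u} [Field k] {A : Type v} [Ring A] [Algebra k A]
variable {𝒜 : ℕ → Submodule k A} [GradedAlgebra 𝒜] {Δ : A →ₐ[k] A ⊗[k] A}
variable {L U : Subalgebra k A} {Γ : Type*} [LinearOrder Γ] {C : Γ → Subalgebra k A}
  {z : Γ → A} {d : Γ → ℕ}

theorem IsStepChain.linearIndependent_left [CharZero k] [Nontrivial A]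
    (h : IsStepChain 𝒜 Δ L U C z d) (hΔ : IsPseudoComul 𝒜 Δ) {ε : A →ₗ[k] k}
    (hε : ∀ a, proj 𝒜 0 a = ε a • (1 : A)) :
    LinearIndependent L (monomial z : NondecSeq Γ → A) := by
  refine linearIndependent_iff'.2 fun s g hs l hl => Subtype.ext ?_
  exact h.coeff_eq_zero hΔ hε (Or.inl rfl) _ s (fun l => (g l : A)) le_rfl
    (fun l => (g l).2) hs l hl

theorem IsStepChain.linearIndependent_right [CharZero k] [Nontrivial A]
    (h : IsStepChain 𝒜 Δ L U C z d) (hΔ : IsPseudoComul 𝒜 Δ) {ε : A →ₗ[k] k}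
    (hε : ∀ a, proj 𝒜 0 a = ε a • (1 : A)) :
    LinearIndependent L.op (monomial z : NondecSeq Γ → A) := by
  refine linearIndependent_iff'.2 fun s g hs l hl => Subtype.ext (MulOpposite.unop_injective ?_)
  exact h.coeff_eq_zero hΔ hε (Or.inr rfl) _ s (fun l => (g l : Aᵐᵒᵖ).unop) le_rfl
    (fun l => (g l).2) hs l hl

theorem IsStepChain.span_left (h : IsStepChain 𝒜 Δ L ⊤ C z d) (hL : Admissible 𝒜 Δ L) :
    Submodule.span L (Set.range (monomial z : NondecSeq Γ → A)) = ⊤ := by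
  refine eq_top_iff.2 fun a _ => ?_
  have ha := h.le_monomialSums hL admissible_top (Or.inl rfl) (a := a) trivial
  induction ha using AddSubmonoid.closure_induction with
  | zero => exact zero_mem _
  | add x y _ _ hx hy => exact add_mem (hx trivial) (hy trivial)
  | mem x hx =>
    obtain ⟨b, hb, l, -, rfl⟩ := hx
    exact Submodule.smul_mem _ (⟨b, hb⟩ : L) (Submodule.subset_span ⟨l, rfl⟩)

theorem IsStepChain.span_right (h : IsStepChain 𝒜 Δ L ⊤ C z d) (hL : Admissible 𝒜 Δ L) :
    Submodule.span L.op (Set.range (monomial z : NondecSeq Γ → A)) = ⊤ := by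
  refine eq_top_iff.2 fun a _ => ?_
  have ha := h.le_monomialSums hL admissible_top (Or.inr rfl) (a := a) trivial
  induction ha using AddSubmonoid.closure_induction with
  | zero => exact zero_mem _
  | add x y _ _ hx hy => exact add_mem (hx trivial) (hy trivial)
  | mem x hx =>
    obtain ⟨b, hb, l, -, rfl⟩ := hx
    exact Submodule.smul_mem _ (⟨MulOpposite.op b, hb⟩ : L.op) (Submodule.subset_span ⟨l, rfl⟩)

theorem IsStepChain.mem_right (h : IsStepChain 𝒜 Δ L U C z d) (γ : Γ) : z γ ∈ U :=
  h.adjoin_le γ (mem_sup_adjoin _ _)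

theorem coe_monomial {B : Subalgebra k A} (z : Γ → B) (l : NondecSeq Γ) :
    ((monomial z l : B) : A) = monomial (fun γ => (z γ : A)) l := by
  simp only [monomial]
  change B.val _ = _
  rw [map_list_prod, List.map_map]; rfl

theorem IsStepChain.linearIndependent_of_bot [CharZero k] [Nontrivial A]
    (h : IsStepChain 𝒜 Δ ⊥ U C z d) (hΔ : IsPseudoComul 𝒜 Δ) {ε : A →ₗ[k] k}
    (hε : ∀ a, proj 𝒜 0 a = ε a • (1 : A)) :
    LinearIndependent k (monomial (fun γ => (⟨z γ, h.mem_right γ⟩ : U)) : NondecSeq Γ → U) := by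
  refine LinearIndependent.of_comp U.val.toLinearMap
    (linearIndependent_iff'.2 fun s g hs l hl => ?_)
  have := h.coeff_eq_zero hΔ hε (Or.inl rfl) _ s (fun l => algebraMap k A (g l)) le_rfl
    (fun l => Subalgebra.algebraMap_mem _ _) (by
      rw [← hs]
      refine Finset.sum_congr rfl fun l _ => ?_
      rw [Function.comp_apply, LinearMap.mul_apply', ← Algebra.smul_def]
      exact congrArg (g l • ·) (coe_monomial (fun γ => (⟨z γ, h.mem_right γ⟩ : U)) l).symm) l hl
  exact (map_eq_zero_iff _ (FaithfulSMul.algebraMap_injective k A)).1 this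

theorem IsStepChain.span_of_bot (h : IsStepChain 𝒜 Δ ⊥ U C z d) (hU : Admissible 𝒜 Δ U) :
    Submodule.span k (Set.range
      (monomial (fun γ => (⟨z γ, h.mem_right γ⟩ : U)) : NondecSeq Γ → U)) = ⊤ := by
  refine eq_top_iff.2 fun a _ => ?_
  have key : ∀ x ∈ monomialSums ⊥ z (LinearMap.mul k A) Set.univ,
      x ∈ (Submodule.span k (Set.range
        (monomial (fun γ => (⟨z γ, h.mem_right γ⟩ : U)) : NondecSeq Γ → U))).map
          U.val.toLinearMap := by
    intro x hx
    induction hx using AddSubmonoid.closure_induction with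
    | zero => exact zero_mem _
    | add x y _ _ hx hy => exact add_mem hx hy
    | mem x hx =>
      obtain ⟨b, hb, l, -, rfl⟩ := hx
      obtain ⟨r, rfl⟩ := Algebra.mem_bot.1 hb
      rw [LinearMap.mul_apply', ← Algebra.smul_def]
      exact Submodule.smul_mem _ _ ⟨_, Submodule.subset_span ⟨l, rfl⟩,
        coe_monomial (fun γ => (⟨z γ, h.mem_right γ⟩ : U)) l⟩
  obtain ⟨y, hy, hya⟩ := key _ (h.le_monomialSums admissible_bot hU (Or.inl rfl) a.2)
  have : y = a := Subtype.ext hya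
  exact this ▸ hy

theorem IsStepChain.gkdim_eq_of_bot [CharZero k] [Nontrivial A]
    (h : IsStepChain 𝒜 Δ ⊥ U C z d) (hU : Admissible 𝒜 Δ U) (hΔ : IsPseudoComul 𝒜 Δ)
    {ε : A →ₗ[k] k} (hε : ∀ a, proj 𝒜 0 a = ε a • (1 : A)) :
    gkdim k U = ((ENat.card Γ : ℕ∞) : ℝ≥0∞) := by
  set y : Γ → U := fun γ => ⟨z γ, h.mem_right γ⟩ with hy
  refine gkdim_eq_card (𝒜 := 𝒜) U.val Subtype.val_injective
    (m := fun e => monomial y (nondecSeqEquiv e))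
    ((h.linearIndependent_of_bot hΔ hε).comp _ nondecSeqEquiv.injective) ?_
    (fun γ => (h.step γ).one_le) (fun e => ?_) y fun e V hV => monomial_mem_pow e hV
  · rw [← h.span_of_bot hU]
    exact congrArg _ (nondecSeqEquiv.surjective.range_comp (monomial y))
  · rw [← sum_map_nondecSeqEquiv]
    change ((monomial y (nondecSeqEquiv e) : U) : A) ∈ _
    rw [coe_monomial]
    exact list_prod_mem_deg (fun γ => (h.step γ).mem_deg) _

theorem IsStepChain.gkdim_eq_add [CharZero k] [Nontrivial A] {B : Subalgebra k A}
    {Γ' : Type*} [LinearOrder Γ'] {C' : Γ' → Subalgebra k A} {z' : Γ' → A} {d' : Γ' → ℕ}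
    (h' : IsStepChain 𝒜 Δ ⊥ B C' z' d') (h : IsStepChain 𝒜 Δ B ⊤ C z d)
    (hB : Admissible 𝒜 Δ B) (hΔ : IsPseudoComul 𝒜 Δ)
    {ε : A →ₗ[k] k} (hε : ∀ a, proj 𝒜 0 a = ε a • (1 : A)) :
    gkdim k A = ((ENat.card Γ' : ℕ∞) : ℝ≥0∞) + ((ENat.card Γ : ℕ∞) : ℝ≥0∞) := by
  rw [← ENat.toENNReal_add, ← ENat.card_sum]
  set y : Γ' → B := fun γ => ⟨z' γ, h'.mem_right γ⟩ with hy
  let E : (Γ' ⊕ Γ →₀ ℕ) ≃ NondecSeq Γ' × NondecSeq Γ :=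
    Finsupp.sumFinsuppEquivProdFinsupp.trans (nondecSeqEquiv.prodCongr nondecSeqEquiv)
  let f : NondecSeq Γ' × NondecSeq Γ → A := fun p => monomial y p.1 • monomial z p.2
  have hf : ∀ p, f p = monomial z' p.1 * monomial z p.2 := fun p => by
    change ((monomial y p.1 : B) : A) * _ = _
    rw [coe_monomial]
  -- A k-basis of `B` times a left `B`-basis of `A` is a k-basis of `A`, consisting of monomials in
  -- the generators of both chains.
  have hli : LinearIndependent k f :=
    linearIndependent_smul (h'.linearIndependent_of_bot hΔ hε) (h.linearIndependent_left hΔ hε)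
  have hspan : Submodule.span k (Set.range f) = ⊤ := by
    have h1 := Submodule.span_smul_of_span_eq_top (h'.span_of_bot hB)
      (Set.range (monomial z : NondecSeq Γ → A))
    rw [h.span_left hB, Submodule.restrictScalars_top] at h1
    rw [← h1]
    congr 1
    ext x
    constructor
    · rintro ⟨p, rfl⟩
      exact Set.smul_mem_smul ⟨p.1, rfl⟩ ⟨p.2, rfl⟩
    · rintro ⟨_, ⟨l, rfl⟩, _, ⟨l', rfl⟩, rfl⟩
      exact ⟨(l, l'), rfl⟩
  have hsum : ∀ (e : Γ' ⊕ Γ →₀ ℕ) (w : Γ' ⊕ Γ → ℕ → ℕ), e.sum w =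
      (Finsupp.sumFinsuppEquivProdFinsupp e).1.sum (fun γ n => w (Sum.inl γ) n) +
        (Finsupp.sumFinsuppEquivProdFinsupp e).2.sum (fun γ n => w (Sum.inr γ) n) := by
    intro e w
    obtain ⟨p, rfl⟩ := Finsupp.sumFinsuppEquivProdFinsupp.symm.surjective e
    rw [Equiv.apply_symm_apply]
    exact Finsupp.sum_sumElim _ _ _
  refine gkdim_eq_card (𝒜 := 𝒜) (AlgHom.id k A) Function.injective_id (m := f ∘ E)
    (hli.comp _ E.injective) (by rw [E.surjective.range_comp, hspan]) (d := Sum.elim d' d)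
    (by
      rintro (γ | γ)
      · exact (h'.step γ).one_le
      · exact (h.step γ).one_le)
    (fun e => ?_) (Sum.elim z' z) fun e V hV => ?_
  · rw [hsum]
    change f (E e) ∈ _
    rw [hf]
    refine SetLike.mul_mem_graded ?_ ?_
    · have := list_prod_mem_deg (fun γ => (h'.step γ).mem_deg)
        (nondecSeqEquiv (Finsupp.sumFinsuppEquivProdFinsupp e).1).1
      rwa [sum_map_nondecSeqEquiv] at this
    · have := list_prod_mem_deg (fun γ => (h.step γ).mem_deg)
        (nondecSeqEquiv (Finsupp.sumFinsuppEquivProdFinsupp e).2).1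
      rwa [sum_map_nondecSeqEquiv] at this
  · rw [hsum, pow_add]
    change f (E e) ∈ _
    rw [hf]
    refine Submodule.mul_mem_mul (monomial_mem_pow _ fun γ hγ => ?_)
      (monomial_mem_pow _ fun γ hγ => ?_)
    · exact hV (Sum.inl γ) (by simpa using hγ)
    · exact hV (Sum.inr γ) (by simpa using hγ)

end Main

end PseudoComul

theorem mainTheorem2 {k : Type u} [Field k] [CharZero k] {A : Type v} [Ring A] [Nontrivial A]
    [Algebra k A] (𝒜 : ℕ → Submodule k A) [GradedAlgebra 𝒜]
    (connected : 𝒜 0 = Submodule.span k {(1 : A)})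
    (B : Subalgebra k A) (hB : DirectSum.SetLike.IsHomogeneous 𝒜 B)
    (Δ : A →ₐ[k] A ⊗[k] A) (hΔ : PseudoComul.IsPseudoComul 𝒜 Δ)
    (hΔB : ∀ b ∈ B,
      Δ b ∈ PseudoComul.tensorSub (Subalgebra.toSubmodule B) (Subalgebra.toSubmodule B)) :
    ∃ (Γ : Type v) (_ : LinearOrder Γ) (z : Γ → A) (d : Γ → ℕ),
      -- each `z γ` is homogeneous of degree `d γ ≥ 1`
      (∀ γ, 1 ≤ d γ ∧ z γ ≠ 0 ∧ z γ ∈ 𝒜 (d γ)) ∧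
      -- triangular coproduct
      (∀ γ, Δ (z γ) - (1 ⊗ₜ[k] z γ + z γ ⊗ₜ[k] 1) ∈
        PseudoComul.tensorSub (PseudoComul.belowPos 𝒜 B z γ) (PseudoComul.belowPos 𝒜 B z γ) ⊓
          PseudoComul.tensorGrading 𝒜 (d γ)) ∧
      -- commutators
      (∀ γ, ∀ a ∈ PseudoComul.below B z γ,
        z γ * a - a * z γ ∈ PseudoComul.below B z γ) ∧
      -- the ordered monomials are homogeneous, and they form a basis of `A` as a left
      -- `B`-module and as a right `B`-module (a left module over the opposite of `B`)
      (∀ l : PseudoComul.NondecSeq Γ, PseudoComul.monomial z l ∈ 𝒜 (l.1.map d).sum) ∧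
      (LinearIndependent B (PseudoComul.monomial z : PseudoComul.NondecSeq Γ → A) ∧
        Submodule.span B (Set.range (PseudoComul.monomial z : PseudoComul.NondecSeq Γ → A)) = ⊤) ∧
      (LinearIndependent B.op (PseudoComul.monomial z : PseudoComul.NondecSeq Γ → A) ∧
        Submodule.span B.op
          (Set.range (PseudoComul.monomial z : PseudoComul.NondecSeq Γ → A)) = ⊤) ∧
      -- Gelfand-Kirillov dimension
      PseudoComul.gkdim k A = PseudoComul.gkdim k B + ((ENat.card Γ : ℕ∞) : ℝ≥0∞) := by
  obtain ⟨ε, hε⟩ := PseudoComul.exists_counit 𝒜 connected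
  have hconn : ∀ a, ∃ c : k, GradedAlgebra.proj 𝒜 0 a = c • (1 : A) := fun a => ⟨ε a, hε a⟩
  have hBadm : PseudoComul.Admissible 𝒜 Δ B := fun b hb =>
    ⟨fun i => by rw [GradedAlgebra.proj_apply]; exact hB i hb,
      PseudoComul.mem_tensorSq.2 (hΔB b hb)⟩
  -- The chain from k to `B` serves only to compute the two dimensions; the generators in the
  -- theorem come from the chain from `B` to `A`.
  obtain ⟨Γ', _, C', z', d', h'⟩ :=
    PseudoComul.exists_stepChain hΔ hconn bot_le PseudoComul.admissible_bot hBadm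
  obtain ⟨Γ, _, C, z, d, h⟩ :=
    PseudoComul.exists_stepChain hΔ hconn le_top hBadm PseudoComul.admissible_top
  have hbelow := h.below_eq hBadm
  refine ⟨Γ, inferInstance, z, d, fun γ => ⟨(h.step γ).one_le, fun h0 => ?_, (h.step γ).mem_deg⟩,
    fun γ => ⟨?_, (hΔ.primitive_mod _ (h.step γ).one_le _ (h.step γ).mem_deg).2⟩,
    fun γ a ha => ?_, fun l => PseudoComul.list_prod_mem_deg (fun γ => (h.step γ).mem_deg) l.1,
    ⟨h.linearIndependent_left hΔ hε, h.span_left hBadm⟩,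
    ⟨h.linearIndependent_right hΔ hε, h.span_right hBadm⟩, ?_⟩
  · exact (h.step γ).notMem (h0 ▸ zero_mem _)
  · rw [PseudoComul.belowPos, hbelow]
    exact (h.step γ).primitive_mod hΔ
  · rw [hbelow] at ha ⊢
    exact (h.step γ).comm_mem a ha
  · rw [h'.gkdim_eq_add h hBadm hΔ hε, h'.gkdim_eq_of_bot hBadm hΔ hε]
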